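/- Consider walks in $\mathbb{Z}^2$ with Kreweras steps $(1,1)$, $(-1,0)$, $(0,-1)$, starting at $(0,0)$ and all of whose vertices lie in the three-quadrant cone $\mathcal C=\{(i,j)\in\mathbb{Z}^2 : i\ge 0 \text{ or } j\ge 0\}$. Let $c_{i,j}(n)$ be the number of such walks with $n$ steps ending at $(i,j)$, and let $C_{i,j}=\sum_{n\ge0}c_{i,j}(n)t^n$. Let $V,W,Z\in\mathbb{Q}[[t]]$ be the unique formal power series satisfying $$V=t(2+V^3),\qquad 4W(1-W)=V^3 \text{ and } W(0)=0,\qquad 2Z=W(1+Z^2).$$ All fields below are subfields of $\mathbb{Q}((t))$. The series $V$, $W$, $Z$ are algebraic over $\mathbb{Q}(t)$ of degrees $3$, $6$, $12$ respectively. There is a tower $\mathbb{Q}(t^3)\subset\mathbb{Q}(V^3)\subset\mathbb{Q}(W)\subset\mathbb{Q}(Z)$ of extensions of respective degrees $3$, $2$, $2$, and $\mathbb{Q}(t,Z)$ is an extension of degree $12$ of $\mathbb{Q}(t)$. Moreover: 1. For every $(i,j)\in\mathcal C$, the series $C_{i,j}$ is algebraic over $\mathbb{Q}(t)$ of degree at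 most $12$ and belongs to $\mathbb{Q}(t,Z)$. More precisely, $t^{i+j}C_{i,j}\in\mathbb{Q}(Z)$. 2. If $i,j\ge 0$ and $i=j$ or $i=j\pm1$, then $t^{i+j}C_{i,j}$ is algebraic over $\mathbb{Q}(t)$ of degree at most $6$ and belongs to $\mathbb{Q}(W)$. 3. For instance, $$C_{0,0}=\frac{(1+2W-2W^2)(3W^3-2W^2-4W+4)}{4(1-W)},$$ $$tC_{0,1}=\frac{C_{0,0}-1}{2}=\frac{W(-6W^4+10W^3+7W^2-18W+8)}{8(1-W)},$$ $$t^2C_{1,1}=\frac{W(35W^6-100W^5+20W^4+144W^3-96W^2-32W+32)}{64(1-W)(1+2W-2W^2)},$$ $$t^2C_{-1,0}=\frac{Z(Z^3+3Z^2-3Z+1)}{Z^4+4Z^3-6Z^2+4Z+1}.$$ -/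

import Mathlib

open scoped PowerSeries

namespace Kreweras

/-- The three-quadrant cone `{(i, j) : i ≥ 0 or j ≥ 0}`. -/
def cone : Set (ℤ × ℤ) := {p | 0 ≤ p.1 ∨ 0 ≤ p.2}

/-- The Kreweras steps: north-east, west and south. -/
def steps : Set (ℤ × ℤ) := {(1, 1), (-1, 0), (0, -1)}

/-- The walks of length `n` (given by their `n + 1` successive vertices) with Kreweras steps,
starting from `(0, 0)`, staying in the three-quadrant cone and ending at `p`. -/
def walks (n : ℕ) (p : ℤ × ℤ) : Set (Fin (n + 1) → ℤ × ℤ) :=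
  {w | w 0 = (0, 0) ∧ w (Fin.last n) = p ∧ (∀ k, w k ∈ cone) ∧
    ∀ k : Fin n, w k.succ - w k.castSucc ∈ steps}

/-- There are finitely many walks of given length and endpoint, so that `Set.ncard` counts them. -/
theorem walks_finite (n : ℕ) (p : ℤ × ℤ) : (walks n p).Finite := by
  have key : ∀ w ∈ walks n p, ∀ m (hm : m < n + 1),
      w ⟨m, hm⟩ ∈ Set.Icc ((-(m : ℤ), -(m : ℤ)) : ℤ × ℤ) ((m : ℤ), (m : ℤ)) := by
    rintro w ⟨h0, -, -, hs⟩ m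
    induction m with
    | zero =>
      intro hm
      have : w ⟨0, hm⟩ = (0, 0) := h0
      rw [this]
      simp
    | succ m ih =>
      intro hm
      have h1 := ih (by omega)
      have h2 := hs ⟨m, by omega⟩
      simp only [Fin.succ_mk, Fin.castSucc_mk] at h2
      simp only [Set.mem_Icc, Prod.le_def] at h1 ⊢
      simp only [steps, Set.mem_insert_iff, Set.mem_singleton_iff, Prod.ext_iff, Prod.fst_sub,
        Prod.snd_sub] at h2
      push_cast
      omega
  have hfin : (Set.univ.pi fun _ : Fin (n + 1) =>
      Set.Icc ((-(n : ℤ), -(n : ℤ)) : ℤ × ℤ) ((n : ℤ), (n : ℤ))).Finite :=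
    Set.Finite.pi fun _ => Set.finite_Icc _ _
  refine hfin.subset fun w hw k _ => ?_
  have h := key w hw k.1 k.2
  have hk := k.2
  simp only [Set.mem_Icc, Prod.le_def, Fin.eta] at h ⊢
  omega

/-- The number `c_{i,j}(n)` of walks of length `n` in the three-quadrant cone ending at `(i, j)`. -/
noncomputable def count (i j : ℤ) (n : ℕ) : ℕ := (walks n (i, j)).ncard

/-- A map on power series that is contracting for the `X`-adic topology of the ideal `(X)` has a
unique fixed point in this ideal. -/
theorem existsUnique_fixedPoint (F : ℚ⟦X⟧ → ℚ⟦X⟧)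
    (h0 : ∀ f, PowerSeries.X ∣ f → PowerSeries.X ∣ F f)
    (hc : ∀ f g n, PowerSeries.X ∣ f → PowerSeries.X ∣ g →
      PowerSeries.X ^ n ∣ f - g → PowerSeries.X ^ (n + 1) ∣ F f - F g) :
    ∃! f, PowerSeries.X ∣ f ∧ F f = f := by
  have eq_of : ∀ f g : ℚ⟦X⟧, (∀ n, PowerSeries.X ^ n ∣ f - g) → f = g := by
    intro f g h
    ext n
    have := PowerSeries.X_pow_dvd_iff.1 (h (n + 1)) n (Nat.lt_succ_self n)
    rwa [map_sub, sub_eq_zero] at this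
  let a : ℕ → ℚ⟦X⟧ := fun n => F^[n] 0
  have ha : ∀ n, a (n + 1) = F (a n) := fun n => Function.iterate_succ_apply' F n 0
  have haX : ∀ n, PowerSeries.X ∣ a n := by
    intro n
    induction n with
    | zero => exact dvd_zero _
    | succ n ih => rw [ha]; exact h0 _ ih
  have hstep : ∀ n, PowerSeries.X ^ n ∣ a (n + 1) - a n := by
    intro n
    induction n with
    | zero => simp
    | succ n ih =>
      rw [ha (n + 1), ha n]
      exact hc _ _ _ (ha n ▸ haX (n + 1)) (haX n) (ha n ▸ ih)
  have hstab : ∀ m k, PowerSeries.coeff m (a (m + 1 + k)) = PowerSeries.coeff m (a (m + 1)) := by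
    intro m k
    induction k with
    | zero => rfl
    | succ k ih =>
      have := PowerSeries.X_pow_dvd_iff.1 (hstep (m + 1 + k)) m (by omega)
      rw [map_sub, sub_eq_zero] at this
      rw [← ih, ← this]
      rfl
  let f : ℚ⟦X⟧ := PowerSeries.mk fun m => PowerSeries.coeff m (a (m + 1))
  have hf : ∀ n, PowerSeries.X ^ n ∣ f - a n := by
    intro n
    refine PowerSeries.X_pow_dvd_iff.2 fun m hm => ?_
    obtain ⟨k, rfl⟩ := Nat.exists_eq_add_of_le (Nat.succ_le_of_lt hm)
    rw [map_sub, PowerSeries.coeff_mk, sub_eq_zero]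
    exact (hstab m k).symm
  have hfX : PowerSeries.X ∣ f := by
    have h1 := hf 1
    rw [pow_one] at h1
    have := dvd_add h1 (haX 1)
    rwa [sub_add_cancel] at this
  refine ⟨f, ⟨hfX, eq_of _ _ fun n => ?_⟩, ?_⟩
  · have h1 := hc f (a n) n hfX (haX n) (hf n)
    have h2 := hf (n + 1)
    rw [← ha] at h1
    have h3 := dvd_sub h1 h2
    rw [sub_sub_sub_cancel_right] at h3
    exact (pow_dvd_pow _ (Nat.le_succ n)).trans h3
  · rintro g ⟨hgX, hg⟩
    refine eq_of _ _ fun n => ?_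
    induction n with
    | zero => simp
    | succ n ih =>
      have := hc g f n hgX hfX ih
      rwa [hg, show F f = f from eq_of _ _ fun n => ?_] at this
      have h1 := hc f (a n) n hfX (haX n) (hf n)
      have h2 := hf (n + 1)
      rw [← ha] at h1
      have h3 := dvd_sub h1 h2
      rw [sub_sub_sub_cancel_right] at h3
      exact (pow_dvd_pow _ (Nat.le_succ n)).trans h3

theorem existsUnique_V : ∃! V : ℚ⟦X⟧, V = PowerSeries.X * (2 + V ^ 3) := by
  obtain ⟨V, ⟨-, hV⟩, huniq⟩ := existsUnique_fixedPoint
    (fun f => PowerSeries.X * (2 + f ^ 3)) (fun f _ => dvd_mul_right _ _) (by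
      rintro f g n - - ⟨c, hc⟩
      refine ⟨c * (f ^ 2 + f * g + g ^ 2), ?_⟩
      linear_combination (PowerSeries.X * (f ^ 2 + f * g + g ^ 2)) * hc)
  exact ⟨V, hV.symm, fun U hU => huniq U ⟨⟨_, hU⟩, hU.symm⟩⟩

/-- The unique formal power series `V` in `t` such that `V = t (2 + V ^ 3)`. -/
noncomputable def serV : ℚ⟦X⟧ := existsUnique_V.choose

theorem serV_eq : serV = PowerSeries.X * (2 + serV ^ 3) := existsUnique_V.choose_spec.1

theorem existsUnique_W :
    ∃! W : ℚ⟦X⟧, 4 * W * (1 - W) = serV ^ 3 ∧ PowerSeries.constantCoeff W = 0 := by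
  have h4 : (4 : ℚ⟦X⟧) * PowerSeries.C (1 / 4 : ℚ) = 1 := by
    rw [show (4 : ℚ⟦X⟧) = PowerSeries.C (4 : ℚ) from (map_ofNat PowerSeries.C 4).symm, ← map_mul]
    norm_num
  have hVX : PowerSeries.X ∣ serV := ⟨_, serV_eq⟩
  obtain ⟨W, ⟨hX, hW⟩, huniq⟩ := existsUnique_fixedPoint
    (fun f => f ^ 2 + PowerSeries.C (1 / 4 : ℚ) * serV ^ 3)
    (fun f hf => dvd_add (dvd_pow hf two_ne_zero)
      (Dvd.dvd.mul_left (dvd_pow hVX three_ne_zero) _)) (by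
      rintro f g n ⟨a, ha⟩ ⟨b, hb⟩ ⟨c, hc⟩
      refine ⟨c * (a + b), ?_⟩
      have h : f + g = PowerSeries.X * (a + b) := by rw [ha, hb]; ring
      linear_combination (f + g) * hc + (PowerSeries.X ^ n * c) * h)
  refine ⟨W, ⟨?_, PowerSeries.X_dvd_iff.1 hX⟩, fun U ⟨hU, hU0⟩ =>
    huniq U ⟨PowerSeries.X_dvd_iff.2 hU0, ?_⟩⟩
  · linear_combination (-4) * hW + serV ^ 3 * h4
  · linear_combination (-PowerSeries.C (1 / 4 : ℚ)) * hU + (U - U ^ 2) * h4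

/-- The unique formal power series `W` in `t` such that `4 W (1 - W) = V ^ 3` and `W(0) = 0`. -/
noncomputable def serW : ℚ⟦X⟧ := existsUnique_W.choose

theorem serW_eq : 4 * serW * (1 - serW) = serV ^ 3 := existsUnique_W.choose_spec.1.1

theorem constantCoeff_serW : PowerSeries.constantCoeff serW = 0 := existsUnique_W.choose_spec.1.2

theorem existsUnique_Z : ∃! Z : ℚ⟦X⟧, 2 * Z = serW * (1 + Z ^ 2) := by
  have h2 : (2 : ℚ⟦X⟧) * PowerSeries.C (1 / 2 : ℚ) = 1 := by
    rw [show (2 : ℚ⟦X⟧) = PowerSeries.C (2 : ℚ) from (map_ofNat PowerSeries.C 2).symm, ← map_mul]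
    norm_num
  obtain ⟨d, hd⟩ : PowerSeries.X ∣ serW := PowerSeries.X_dvd_iff.2 constantCoeff_serW
  obtain ⟨Z, ⟨-, hZ⟩, huniq⟩ := existsUnique_fixedPoint
    (fun f => serW * (PowerSeries.C (1 / 2 : ℚ) * (1 + f ^ 2)))
    (fun f _ => Dvd.dvd.mul_right ⟨d, hd⟩ _) (by
      rintro f g n - - ⟨c, hc⟩
      refine ⟨c * (f + g) * d * PowerSeries.C (1 / 2 : ℚ), ?_⟩
      simp only [hd]
      linear_combination (PowerSeries.X * d * PowerSeries.C (1 / 2 : ℚ) * (f + g)) * hc)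
  have hfix : ∀ U : ℚ⟦X⟧, 2 * U = serW * (1 + U ^ 2) →
      serW * (PowerSeries.C (1 / 2 : ℚ) * (1 + U ^ 2)) = U := fun U hU => by
    linear_combination (-PowerSeries.C (1 / 2 : ℚ)) * hU + U * h2
  refine ⟨Z, ?_, fun U hU => huniq U ⟨?_, hfix U hU⟩⟩
  · simp only at hZ ⊢
    linear_combination (-2) * hZ + serW * (1 + Z ^ 2) * h2
  · rw [← hfix U hU]
    exact Dvd.dvd.mul_right ⟨d, hd⟩ _

/-- The unique formal power series `Z` in `t` such that `2 Z = W (1 + Z ^ 2)`. -/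
noncomputable def serZ : ℚ⟦X⟧ := existsUnique_Z.choose

theorem serZ_eq : 2 * serZ = serW * (1 + serZ ^ 2) := existsUnique_Z.choose_spec.1

/-! All the series are now seen in the field `ℚ((t))` of Laurent series. -/

/-- The variable `t`. -/
noncomputable def t : LaurentSeries ℚ := ((PowerSeries.X : ℚ⟦X⟧) : LaurentSeries ℚ)

/-- The series `V` in `ℚ((t))`. -/
noncomputable def V : LaurentSeries ℚ := (serV : LaurentSeries ℚ)

/-- The series `W` in `ℚ((t))`. -/
noncomputable def W : LaurentSeries ℚ := (serW : LaurentSeries ℚ)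

/-- The series `Z` in `ℚ((t))`. -/
noncomputable def Z : LaurentSeries ℚ := (serZ : LaurentSeries ℚ)

/-- The generating function `C_{i,j} = ∑ₙ c_{i,j}(n) tⁿ` of walks with Kreweras steps that start
from `(0, 0)`, stay in the three-quadrant cone and end at `(i, j)`. -/
noncomputable def C (i j : ℤ) : LaurentSeries ℚ :=
  ((PowerSeries.mk fun n => (count i j n : ℚ) : ℚ⟦X⟧) : LaurentSeries ℚ)

/-- `ℚ(S)`: the smallest subfield of `ℚ((t))` that contains the set of series `S`. -/
noncomputable abbrev field (S : Set (LaurentSeries ℚ)) : IntermediateField ℚ (LaurentSeries ℚ) :=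
  IntermediateField.adjoin ℚ S

/-- The series `f` is algebraic over `K`, of degree `d`. -/
def HasDegree (K : IntermediateField ℚ (LaurentSeries ℚ)) (f : LaurentSeries ℚ) (d : ℕ) : Prop :=
  IsAlgebraic K f ∧ (minpoly K f).natDegree = d

/-- The series `f` is algebraic over `K`, of degree at most `d`. -/
def HasDegreeAtMost (K : IntermediateField ℚ (LaurentSeries ℚ)) (f : LaurentSeries ℚ) (d : ℕ) :
    Prop :=
  IsAlgebraic K f ∧ (minpoly K f).natDegree ≤ d

/-- `L` is a field extension of `K` of (finite) degree `d`, for two subfields of `ℚ((t))`. -/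
def IsExtensionOfDegree (K L : IntermediateField ℚ (LaurentSeries ℚ)) (d : ℕ) : Prop :=
  ∃ h : K ≤ L, Module.Finite K (IntermediateField.extendScalars h) ∧
    Module.finrank K (IntermediateField.extendScalars h) = d

end Kreweras

/-! The cone and the steps are symmetric in the diagonal, so it suffices to follow walks ending at
`(b, b - a)` with `a, b ≥ 0`. Along a walk the length minus `2 i - j` is three times the number `k`
of west steps, so the length is `a + b + 3 k`, and such walks are counted by a series `F` in `x`,
`y` and `s = t ^ 3` with weight `x ^ a y ^ b s ^ k`. Removing the last step gives a linear equation
for `F` with kernel `x y (1 - x - y) - s`. Its unknowns are `F`, the diagonal part `D(y)` and the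
part `R(x)` of the walks ending at `b = 0`, `a > 0`.

On the curve `s = x y z`, `x + y + z = 1`, the kernel vanishes. With `A = 1 + y D` and `B = 1 - 2 x
- 2 (s / x) R`, what remains is `A(y) (x - z) = - B(x)`. An argument by orders in `s`
(`eq_zero_of_curve`) shows that at most one pair `(D, R)` solves it, so it is enough to exhibit a
solution.

Put `p = 1 + V ^ 3 / 2`, so that `4 s p ^ 3 = p - 1`, and `S(x) = √(1 - p (p + 1) x + p ^ 2 x ^ 2)`.
The function `N(x) = (s / x + 2 p s - x / p) S(x)` satisfies `N(x) = - N(y)` on the curve. With `e =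
x y + y z + z x` and a suitable constant `c'`, take `B(x) ^ 2 = c' - 2 e + 2 N(x)`. The product
`B(x) ^ 2 B(y) ^ 2` is then symmetric in `x, y, z`, and the identities `norm_on_curve` and
`discriminant_on_curve` lead to `A(y) = r (1 - 2 p y) / (B(y) S(y))` with `r = B(0)`. The
verification is `evy_serA_mul_sub`.

Here `p`, `S ^ 2`, `B ^ 2` and `r ^ 2` are rational over `ℚ(W)`, while `r = (1 + W) √(1 - W ^ 2) /
p` lies in `ℚ(Z)`. Since `A(0) = 1`, the coefficients of `A`, hence the diagonal series, lie in
`ℚ(W)`; those of `B` lie in `ℚ(Z)`. The recurrences then give all other endpoints (`foldSer_mem`).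

For the degrees, `t ^ 3`, `V ^ 3` and `W` are explicit rational functions of `V ^ 3`, `W` and `Z`,
and the degree of such an extension is the degree of the rational function. Adjoining `t` to a field
of series in `t ^ 3` has degree 3, because `t ^ 3` is not a cube there, and this transfers the
degrees to the base `ℚ(t)`. -/

namespace Kreweras

/-! ### Evaluation of power series at a series without constant term -/

section Evaluation

variable {τ S B : Type*} [CommRing S] [CommRing B]

open scoped MvPowerSeries.WithPiTopology in
/-- Evaluation of power series over `B` at a multivariate power series `y` without constant
term, along a ring homomorphism `φ` on the coefficients (on which no continuity is imposed). -/
noncomputable def evalHom (φ : B →+* MvPowerSeries τ S) (y : MvPowerSeries τ S)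
    (hy : MvPowerSeries.constantCoeff y = 0) : B⟦X⟧ →+* MvPowerSeries τ S :=
  -- The discrete topology on `B` makes every `φ` continuous; the discrete topology on `S` makes
  -- convergence in `MvPowerSeries τ S` coefficientwise stabilisation.
  letI : UniformSpace B := ⊥
  letI : UniformSpace S := ⊥
  PowerSeries.eval₂Hom (φ := φ) (a := y) continuous_of_discreteTopology
    (MvPowerSeries.WithPiTopology.isTopologicallyNilpotent_of_constantCoeff_zero hy)

variable (φ : B →+* MvPowerSeries τ S) {y : MvPowerSeries τ S}
  (hy : MvPowerSeries.constantCoeff y = 0)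

open scoped MvPowerSeries.WithPiTopology in
theorem hasSum_evalHom (f : B⟦X⟧) :
    letI : UniformSpace S := ⊥
    HasSum (fun n => φ (PowerSeries.coeff n f) * y ^ n) (evalHom φ y hy f) := by
  let : UniformSpace B := ⊥
  let : UniformSpace S := ⊥
  have hy' := MvPowerSeries.WithPiTopology.isTopologicallyNilpotent_of_constantCoeff_zero hy
  have hφ : Continuous φ := continuous_of_discreteTopology
  have h : ⇑(evalHom φ y hy) = PowerSeries.eval₂ φ y := PowerSeries.coe_eval₂Hom hφ hy'
  rw [h]
  exact PowerSeries.hasSum_eval₂ hφ hy' f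

open scoped MvPowerSeries.WithPiTopology in
@[simp]
theorem evalHom_C (b : B) : evalHom φ y hy (PowerSeries.C b) = φ b := by
  let : UniformSpace B := ⊥
  let : UniformSpace S := ⊥
  have hy' := MvPowerSeries.WithPiTopology.isTopologicallyNilpotent_of_constantCoeff_zero hy
  have hφ : Continuous φ := continuous_of_discreteTopology
  have h : ⇑(evalHom φ y hy) = PowerSeries.eval₂ φ y := PowerSeries.coe_eval₂Hom hφ hy'
  rw [h]
  exact PowerSeries.eval₂_C φ y b

open scoped MvPowerSeries.WithPiTopology in
@[simp]
theorem evalHom_X : evalHom φ y hy PowerSeries.X = y := by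
  let : UniformSpace B := ⊥
  let : UniformSpace S := ⊥
  have hy' := MvPowerSeries.WithPiTopology.isTopologicallyNilpotent_of_constantCoeff_zero hy
  have hφ : Continuous φ := continuous_of_discreteTopology
  have h : ⇑(evalHom φ y hy) = PowerSeries.eval₂ φ y := PowerSeries.coe_eval₂Hom hφ hy'
  rw [h]
  exact PowerSeries.eval₂_X φ y

open scoped MvPowerSeries.WithPiTopology in
theorem evalHom_map {A : Type*} [CommRing A] (ψ : A →+* B) (f : A⟦X⟧) :
    evalHom φ y hy (PowerSeries.map ψ f) = evalHom (φ.comp ψ) y hy f := by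
  let : UniformSpace S := ⊥
  refine (hasSum_evalHom φ hy (PowerSeries.map ψ f)).unique ?_
  simpa using hasSum_evalHom (φ.comp ψ) hy f

end Evaluation

/-! ### The kernel curve `s = x y z`, `x + y + z = 1`, and uniqueness on it -/

section Curve

/-- The ring of power series in two variables, the coordinates of the kernel curve. -/
abbrev Pl : Type := MvPowerSeries (Fin 2) ℚ

/-- First coordinate. -/
noncomputable def xx : Pl := MvPowerSeries.X 0

/-- Second coordinate. -/
noncomputable def yy : Pl := MvPowerSeries.X 1

/-- The third root of the kernel. -/
noncomputable def zz : Pl := 1 - xx - yy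

theorem constantCoeff_xx : MvPowerSeries.constantCoeff xx = 0 := by simp [xx]

theorem constantCoeff_yy : MvPowerSeries.constantCoeff yy = 0 := by simp [yy]

theorem constantCoeff_zz : MvPowerSeries.constantCoeff zz = 1 := by simp [zz, xx, yy]

theorem constantCoeff_xyz : MvPowerSeries.constantCoeff (xx * yy * zz) = 0 := by simp [xx]

theorem xx_ne_zero : xx ≠ 0 := fun h => by
  have := congrArg (MvPowerSeries.coeff (Finsupp.single 0 1)) h
  simp [xx] at this

theorem yy_ne_zero : yy ≠ 0 := fun h => by
  have := congrArg (MvPowerSeries.coeff (Finsupp.single 1 1)) h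
  simp [yy] at this

theorem zz_ne_zero : zz ≠ 0 := fun h => by
  have := constantCoeff_zz
  simp [h] at this

/-- Series in `s`, evaluated at `s = x y z`. -/
noncomputable def ev0 : ℚ⟦X⟧ →+* Pl := evalHom MvPowerSeries.C (xx * yy * zz) constantCoeff_xyz

/-- Series in `x` and `s`, evaluated on the curve `s = x y z`. -/
noncomputable def evx : ℚ⟦X⟧⟦X⟧ →+* Pl := evalHom ev0 xx constantCoeff_xx

/-- Series in `y` and `s`, evaluated on the curve `s = x y z`. -/
noncomputable def evy : ℚ⟦X⟧⟦X⟧ →+* Pl := evalHom ev0 yy constantCoeff_yy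

/-- Series in `x`, `y` and `s`, evaluated on the curve `s = x y z`. -/
noncomputable def evxy : ℚ⟦X⟧⟦X⟧⟦X⟧ →+* Pl := evalHom evx yy constantCoeff_yy

theorem ev0_X : ev0 PowerSeries.X = xx * yy * zz := evalHom_X _ _

theorem ev0_C (q : ℚ) : ev0 (PowerSeries.C q) = MvPowerSeries.C q := evalHom_C _ _ _

theorem evx_X : evx PowerSeries.X = xx := evalHom_X _ _

theorem evx_C (f : ℚ⟦X⟧) : evx (PowerSeries.C f) = ev0 f := evalHom_C _ _ _

theorem evy_X : evy PowerSeries.X = yy := evalHom_X _ _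

theorem evy_C (f : ℚ⟦X⟧) : evy (PowerSeries.C f) = ev0 f := evalHom_C _ _ _

theorem evxy_X : evxy PowerSeries.X = yy := evalHom_X _ _

theorem evxy_C (f : ℚ⟦X⟧⟦X⟧) : evxy (PowerSeries.C f) = evx f := evalHom_C _ _ _

/-- A series in `y` and `s` alone sits in the three-variable ring through `PowerSeries.map
PowerSeries.C`; this is how `D(y)` is evaluated in the functional equation. -/
theorem evxy_map_C (f : ℚ⟦X⟧⟦X⟧) : evxy (PowerSeries.map PowerSeries.C f) = evy f := by
  rw [evxy, evalHom_map, evy]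
  have h : evx.comp PowerSeries.C = ev0 := RingHom.ext evx_C
  simp only [h]

/-- Evaluation commutes with constant coefficients. -/
theorem constantCoeff_ev0 (f : ℚ⟦X⟧) :
    MvPowerSeries.constantCoeff (ev0 f) = PowerSeries.constantCoeff f := by
  -- Peeling off the constant term avoids any continuity argument: the remaining multiple of `s`
  -- evaluates to a multiple of `x y z`. The same device serves for the other evaluations and
  -- restrictions.
  conv_lhs => rw [PowerSeries.eq_X_mul_shift_add_const f]
  simp [ev0_X, ev0_C, xx]

theorem constantCoeff_evx (f : ℚ⟦X⟧⟦X⟧) :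
    MvPowerSeries.constantCoeff (evx f) =
      PowerSeries.constantCoeff (PowerSeries.constantCoeff f) := by
  conv_lhs => rw [PowerSeries.eq_X_mul_shift_add_const f]
  simp [evx_X, evx_C, xx, constantCoeff_ev0]

theorem constantCoeff_evy (f : ℚ⟦X⟧⟦X⟧) :
    MvPowerSeries.constantCoeff (evy f) =
      PowerSeries.constantCoeff (PowerSeries.constantCoeff f) := by
  conv_lhs => rw [PowerSeries.eq_X_mul_shift_add_const f]
  simp [evy_X, evy_C, yy, constantCoeff_ev0]

theorem hasSubst_x : MvPowerSeries.HasSubst ![0, (PowerSeries.X : ℚ⟦X⟧)] :=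
  MvPowerSeries.hasSubst_of_constantCoeff_zero fun i => by
    fin_cases i
    · simp
    · exact PowerSeries.constantCoeff_X

theorem hasSubst_y : MvPowerSeries.HasSubst ![(PowerSeries.X : ℚ⟦X⟧), 0] :=
  MvPowerSeries.hasSubst_of_constantCoeff_zero fun i => by
    fin_cases i
    · exact PowerSeries.constantCoeff_X
    · simp

/-- Restriction to the line `x = 0`. -/
noncomputable def resx : Pl →+* ℚ⟦X⟧ := (MvPowerSeries.substAlgHom (R := ℚ) hasSubst_x).toRingHom

/-- Restriction to the line `y = 0`. -/
noncomputable def resy : Pl →+* ℚ⟦X⟧ := (MvPowerSeries.substAlgHom (R := ℚ) hasSubst_y).toRingHom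

theorem resx_xx : resx xx = 0 := MvPowerSeries.substAlgHom_X hasSubst_x 0

theorem resx_yy : resx yy = PowerSeries.X := MvPowerSeries.substAlgHom_X hasSubst_x 1

theorem resy_xx : resy xx = PowerSeries.X := MvPowerSeries.substAlgHom_X hasSubst_y 0

theorem resy_yy : resy yy = 0 := MvPowerSeries.substAlgHom_X hasSubst_y 1

theorem resx_C (q : ℚ) : resx (MvPowerSeries.C q) = PowerSeries.C q :=
  (MvPowerSeries.substAlgHom (R := ℚ) hasSubst_x).commutes q

theorem resy_C (q : ℚ) : resy (MvPowerSeries.C q) = PowerSeries.C q :=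
  (MvPowerSeries.substAlgHom (R := ℚ) hasSubst_y).commutes q

/-- On the line `x = 0` the value `x y z` of `s` vanishes, so only the constant term in `s`
survives. -/
theorem resx_ev0 (f : ℚ⟦X⟧) :
    resx (ev0 f) = PowerSeries.C (PowerSeries.constantCoeff f) := by
  conv_lhs => rw [PowerSeries.eq_X_mul_shift_add_const f]
  simp [ev0_X, ev0_C, resx_xx, resx_C]

theorem resy_ev0 (f : ℚ⟦X⟧) :
    resy (ev0 f) = PowerSeries.C (PowerSeries.constantCoeff f) := by
  conv_lhs => rw [PowerSeries.eq_X_mul_shift_add_const f]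
  simp [ev0_X, ev0_C, resy_yy, resy_C]

theorem resx_evy (f : ℚ⟦X⟧⟦X⟧) :
    resx (evy f) = PowerSeries.map PowerSeries.constantCoeff f := by
  ext n
  induction n generalizing f with
  | zero =>
    conv_lhs => rw [PowerSeries.eq_X_mul_shift_add_const f]
    simp [evy_X, evy_C, resx_yy, resx_ev0]
  | succ n ih =>
    conv_lhs => rw [PowerSeries.eq_X_mul_shift_add_const f]
    simp [evy_X, evy_C, resx_yy, resx_ev0, PowerSeries.coeff_succ_X_mul, ih]

theorem resy_evx (f : ℚ⟦X⟧⟦X⟧) :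
    resy (evx f) = PowerSeries.map PowerSeries.constantCoeff f := by
  ext n
  induction n generalizing f with
  | zero =>
    conv_lhs => rw [PowerSeries.eq_X_mul_shift_add_const f]
    simp [evx_X, evx_C, resy_xx, resy_ev0]
  | succ n ih =>
    conv_lhs => rw [PowerSeries.eq_X_mul_shift_add_const f]
    simp [evx_X, evx_C, resy_xx, resy_ev0, PowerSeries.coeff_succ_X_mul, ih]

theorem resx_evx (f : ℚ⟦X⟧⟦X⟧) :
    resx (evx f) = PowerSeries.C (PowerSeries.constantCoeff (PowerSeries.constantCoeff f)) := by
  conv_lhs => rw [PowerSeries.eq_X_mul_shift_add_const f]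
  simp [evx_X, evx_C, resx_xx, resx_ev0]

theorem resy_evy (f : ℚ⟦X⟧⟦X⟧) :
    resy (evy f) = PowerSeries.C (PowerSeries.constantCoeff (PowerSeries.constantCoeff f)) := by
  conv_lhs => rw [PowerSeries.eq_X_mul_shift_add_const f]
  simp [evy_X, evy_C, resy_yy, resy_ev0]

/-- A series in two variables whose restriction to `s = 0` vanishes is a multiple of `s`. -/
theorem exists_eq_C_X_mul {f : ℚ⟦X⟧⟦X⟧} (hf : PowerSeries.map PowerSeries.constantCoeff f = 0) :
    ∃ g, f = PowerSeries.C PowerSeries.X * g := by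
  have h : ∀ n, ∃ u, PowerSeries.coeff n f = PowerSeries.X * u := fun n => by
    have := congrArg (PowerSeries.coeff n) hf
    rw [PowerSeries.coeff_map, map_zero] at this
    exact PowerSeries.X_dvd_iff.2 this
  choose u hu using h
  refine ⟨PowerSeries.mk u, ?_⟩
  ext1 n
  rw [hu, PowerSeries.coeff_C_mul, PowerSeries.coeff_mk]

theorem powerSeries_two_ne_zero : (2 : ℚ⟦X⟧) ≠ 0 := fun h => by
  have := congrArg PowerSeries.constantCoeff h
  rw [map_ofNat, map_zero] at this
  exact two_ne_zero this

/-- On the curve, `D(y, s) (x - z) = 2 z R(x, s)` with `R(0, s) = 0` has only the zero solution. -/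
theorem eq_zero_of_curve {D R : ℚ⟦X⟧⟦X⟧} (hR : PowerSeries.constantCoeff R = 0)
    (h : evy D * (xx - zz) = 2 * zz * evx R) : D = 0 ∧ R = 0 := by
  have key : ∀ n (D R : ℚ⟦X⟧⟦X⟧), PowerSeries.constantCoeff R = 0 →
      evy D * (xx - zz) = 2 * zz * evx R → ∀ m,
      PowerSeries.coeff n (PowerSeries.coeff m D) = 0 ∧
        PowerSeries.coeff n (PowerSeries.coeff m R) = 0 := by
    intro n
    -- Both coordinate lines lie over `s = 0`. On `x = 0` the right side vanishes because `R(0, s) =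
    -- 0`, so `D(y, 0) = 0`; on `y = 0` the left side then vanishes, so `R(x, 0) = 0`.
    have base : ∀ D R : ℚ⟦X⟧⟦X⟧, PowerSeries.constantCoeff R = 0 →
        evy D * (xx - zz) = 2 * zz * evx R →
        PowerSeries.map PowerSeries.constantCoeff D = 0 ∧
          PowerSeries.map PowerSeries.constantCoeff R = 0 := by
      intro D R hR h
      have hne : (1 - PowerSeries.X : ℚ⟦X⟧) ≠ 0 := fun h0 => by
        have := congrArg PowerSeries.constantCoeff h0
        simp at this
      have hD : PowerSeries.map PowerSeries.constantCoeff D = 0 := by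
        have h1 := congrArg resx h
        simp only [map_mul, map_sub, resx_evy, resx_evx, resx_xx, zz, resx_yy, map_one, hR,
          map_zero, mul_zero, sub_zero, zero_sub] at h1
        exact (mul_eq_zero.1 h1).resolve_right (neg_ne_zero.2 hne)
      refine ⟨hD, ?_⟩
      have h2 := congrArg resy h
      have h0 : PowerSeries.constantCoeff (PowerSeries.constantCoeff D) = 0 := by
        have := congrArg (PowerSeries.coeff 0) hD
        simpa using this
      simp only [map_mul, map_sub, resy_evy, resy_evx, resy_xx, zz, resy_yy, map_one, h0,
        map_zero, zero_mul, sub_zero, map_ofNat] at h2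
      exact (mul_eq_zero.1 h2.symm).resolve_left
        (mul_ne_zero powerSeries_two_ne_zero hne)
    induction n with
    | zero =>
      intro D R hR h m
      have := base D R hR h
      constructor
      · simpa using congrArg (PowerSeries.coeff m) this.1
      · simpa using congrArg (PowerSeries.coeff m) this.2
    | succ n ih =>
      intro D R hR h m
      have hb := base D R hR h
      -- Both series are divisible by `s`; dividing the equation by `x y z` lowers the order in `s`
      -- by one and keeps its form.
      obtain ⟨D', rfl⟩ := exists_eq_C_X_mul hb.1
      obtain ⟨R', rfl⟩ := exists_eq_C_X_mul hb.2
      have hR' : PowerSeries.constantCoeff R' = 0 := by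
        rw [map_mul, PowerSeries.constantCoeff_C] at hR
        exact (mul_eq_zero.1 hR).resolve_left PowerSeries.X_ne_zero
      have h' : evy D' * (xx - zz) = 2 * zz * evx R' := by
        rw [map_mul, map_mul, evx_C, evy_C, ev0_X] at h
        refine mul_left_cancel₀ (mul_ne_zero (mul_ne_zero xx_ne_zero yy_ne_zero) zz_ne_zero) ?_
        linear_combination h
      have := ih D' R' hR' h' m
      simpa [PowerSeries.coeff_C_mul, PowerSeries.coeff_succ_X_mul] using this
  exact ⟨by ext m n; exact (key n D R hR h m).1, by ext m n; exact (key n D R hR h m).2⟩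

end Curve

end Kreweras

namespace Kreweras

/-! ### Last-step recurrences and folding along the diagonal -/

section Counting

theorem count_zero (i j : ℤ) : count i j 0 = if i = 0 ∧ j = 0 then 1 else 0 := by
  unfold count
  split_ifs with h
  · obtain ⟨rfl, rfl⟩ := h
    rw [Set.ncard_eq_one]
    refine ⟨fun _ => (0, 0), Set.ext fun w => ⟨fun hw => ?_, fun hw => ?_⟩⟩
    · ext1 k
      rw [Fin.fin_one_eq_zero k]
      exact hw.1
    · rw [Set.mem_singleton_iff.1 hw]
      exact ⟨rfl, rfl, fun _ => Or.inl le_rfl, fun k => k.elim0⟩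
  · rw [Set.ncard_eq_zero (walks_finite 0 (i, j))]
    refine Set.eq_empty_of_forall_notMem fun w hw => h ?_
    have h1 := hw.1
    have h2 := hw.2.1
    rw [show Fin.last 0 = 0 from rfl, h1] at h2
    simpa [eq_comm] using h2

theorem count_of_notMem_cone {i j : ℤ} (h : (i, j) ∉ cone) (n : ℕ) : count i j n = 0 := by
  unfold count
  rw [Set.ncard_eq_zero (walks_finite n (i, j))]
  exact Set.eq_empty_of_forall_notMem fun w hw => h (hw.2.1 ▸ hw.2.2.1 (Fin.last n))

theorem walks_succ {p : ℤ × ℤ} (hp : p ∈ cone) (n : ℕ) :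
    walks (n + 1) p = (fun w => Fin.snoc (α := fun _ => ℤ × ℤ) w p) ''
      {w | ∃ d ∈ steps, w ∈ walks n (p - d)} := by
  ext w
  constructor
  · rintro ⟨h0, hl, hc, hs⟩
    have hl' : w (Fin.last n).succ = p := hl
    refine ⟨Fin.init w, ⟨p - w (Fin.last n).castSucc, ?_, h0, ?_, fun k => hc _, fun k => ?_⟩, ?_⟩
    · rw [← hl']
      exact hs (Fin.last n)
    · simp [Fin.init]
    · have := hs k.castSucc
      rwa [Fin.succ_castSucc] at this
    · conv_rhs => rw [← Fin.snoc_init_self w]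
      simp only
      rw [hl]
  · rintro ⟨v, ⟨d, hd, h0, hl, hc, hs⟩, rfl⟩
    refine ⟨?_, ?_, fun k => ?_, fun k => ?_⟩
    · have : (0 : Fin (n + 1 + 1)) = (0 : Fin (n + 1)).castSucc := rfl
      simp only [this, Fin.snoc_castSucc, h0]
    · simp only [Fin.snoc_last]
    · refine Fin.lastCases ?_ (fun k => ?_) k
      · simpa only [Fin.snoc_last] using hp
      · simpa only [Fin.snoc_castSucc] using hc k
    · refine Fin.lastCases ?_ (fun k => ?_) k
      · simp only [Fin.succ_last, Fin.snoc_last, Fin.snoc_castSucc, hl]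
        simpa using hd
      · simp only [Fin.succ_castSucc, Fin.snoc_castSucc]
        exact hs k

theorem count_succ {i j : ℤ} (h : (i, j) ∈ cone) (n : ℕ) :
    count i j (n + 1) = count (i - 1) (j - 1) n + count (i + 1) j n + count i (j + 1) n := by
  have hset : {w | ∃ d ∈ steps, w ∈ walks n ((i, j) - d)} =
      walks n (i - 1, j - 1) ∪ walks n (i + 1, j) ∪ walks n (i, j + 1) := by
    ext w
    simp [steps, or_assoc]
  have hdisj : ∀ p q : ℤ × ℤ, p ≠ q → Disjoint (walks n p) (walks n q) := fun p q hpq =>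
    Set.disjoint_left.2 fun w h1 h2 => hpq (h1.2.1.symm.trans h2.2.1)
  unfold count
  rw [walks_succ h, Set.ncard_image_of_injective _ (fun v w hvw => by
    have := congrArg Fin.init hvw
    simpa only [Fin.init_snoc] using this), hset,
    Set.ncard_union_eq _ ((walks_finite _ _).union (walks_finite _ _)) (walks_finite _ _),
    Set.ncard_union_eq _ (walks_finite _ _) (walks_finite _ _)]
  · exact hdisj _ _ fun h => by simp [Prod.ext_iff] at h
  · exact Set.disjoint_union_left.2 ⟨hdisj _ _ fun h => by simp [Prod.ext_iff] at h,
      hdisj _ _ fun h => by simp [Prod.ext_iff] at h⟩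

theorem count_symm (i j : ℤ) (n : ℕ) : count i j n = count j i n := by
  induction n generalizing i j with
  | zero => simp only [count_zero, and_comm]
  | succ n ih =>
    by_cases h : (i, j) ∈ cone
    · have h' : (j, i) ∈ cone := Or.symm h
      rw [count_succ h, count_succ h', ih, ih (i + 1), ih i]
      ring
    · have h' : (j, i) ∉ cone := fun h' => h (Or.symm h')
      rw [count_of_notMem_cone h, count_of_notMem_cone h']

/-- The quantity `n - 2 i + j` is unchanged by the steps `(1, 1)` and `(0, -1)` and grows by 3 with
`(-1, 0)`, so `k` is the number of west steps. -/
theorem exists_of_count_ne_zero {i j : ℤ} {n : ℕ} (h : count i j n ≠ 0) :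
    ∃ k : ℕ, (n : ℤ) = 2 * i - j + 3 * k := by
  induction n generalizing i j with
  | zero =>
    rw [count_zero] at h
    obtain ⟨rfl, rfl⟩ : i = 0 ∧ j = 0 := by
      by_contra h'
      exact h (if_neg h')
    exact ⟨0, by simp⟩
  | succ n ih =>
    have hc : (i, j) ∈ cone := by
      by_contra hc
      exact h (count_of_notMem_cone hc _)
    rw [count_succ hc] at h
    rcases (by omega : count (i - 1) (j - 1) n ≠ 0 ∨ count (i + 1) j n ≠ 0 ∨
      count i (j + 1) n ≠ 0) with h | h | h
    · obtain ⟨k, hk⟩ := ih h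
      exact ⟨k, by push_cast; omega⟩
    · obtain ⟨k, hk⟩ := ih h
      exact ⟨k + 1, by push_cast; omega⟩
    · obtain ⟨k, hk⟩ := ih h
      exact ⟨k, by push_cast; omega⟩

/-- Number of walks with `a + b + 3 k` steps ending at `(b, b - a)`. -/
noncomputable def foldCount (a b k : ℕ) : ℚ := count b (b - a) (a + b + 3 * k)

theorem foldCount_zero_zero_zero : foldCount 0 0 0 = 1 := by
  simp [foldCount, count_zero]

theorem count_eq_zero_of_lt {i j : ℤ} {n : ℕ} (h : (n : ℤ) < 2 * i - j) : count i j n = 0 := by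
  by_contra h'
  obtain ⟨k, hk⟩ := exists_of_count_ne_zero h'
  omega

/-- The contribution of the south step is left as a `count`, since for `a = 0` its starting point
lies above the diagonal. The default values cover a predecessor outside the cone (`b = 0`) and the
absence of west steps (`k = 0`). -/
theorem foldCount_step {a b k n : ℕ} (hn : n + 1 = a + b + 3 * k) :
    foldCount a b k = (if b = 0 then 0 else foldCount a (b - 1) k) +
      (if k = 0 then 0 else foldCount (a + 1) (b + 1) (k - 1)) + count b (b - a + 1) n := by
  have hc : ((b : ℤ), (b : ℤ) - a) ∈ cone := Or.inl (Int.natCast_nonneg b)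
  rw [foldCount, ← hn, count_succ hc]
  push_cast
  congr 2
  · split_ifs with hb
    · subst hb
      rw [count_of_notMem_cone, Nat.cast_zero]
      simp [cone]
      omega
    · obtain ⟨b, rfl⟩ := Nat.exists_eq_succ_of_ne_zero hb
      rw [foldCount, show n = a + b + 3 * k by omega]
      push_cast
      simp only [add_sub_cancel_right]
      congr 2
      ring
  · split_ifs with hk
    · rw [count_eq_zero_of_lt (by omega), Nat.cast_zero]
    · obtain ⟨k, rfl⟩ := Nat.exists_eq_succ_of_ne_zero hk
      rw [foldCount, show n = a + 1 + (b + 1) + 3 * k by omega]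
      push_cast
      congr 2
      ring

theorem foldCount_succ (a b k : ℕ) :
    foldCount (a + 1) b k = (if b = 0 then 0 else foldCount (a + 1) (b - 1) k) +
      (if k = 0 then 0 else foldCount (a + 2) (b + 1) (k - 1)) + foldCount a b k := by
  rw [foldCount_step (show a + b + 3 * k + 1 = a + 1 + b + 3 * k by ring)]
  congr 1
  rw [foldCount]
  push_cast
  congr 2
  ring

/-- The diagonal is entered by a west step from below or by a south step from above; reflection
makes the two contributions equal, hence the factor 2. -/
theorem foldCount_zero (b k : ℕ) :
    foldCount 0 b k = (if b = 0 ∧ k = 0 then 1 else 0) +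
      (if b = 0 then 0 else foldCount 0 (b - 1) k) +
      2 * (if k = 0 then 0 else foldCount 1 (b + 1) (k - 1)) := by
  by_cases h : b = 0 ∧ k = 0
  · obtain ⟨rfl, rfl⟩ := h
    simp [foldCount_zero_zero_zero]
  · obtain ⟨n, hn⟩ : ∃ n, n + 1 = 0 + b + 3 * k := ⟨b + 3 * k - 1, by omega⟩
    rw [foldCount_step hn, if_neg h, zero_add, zero_add, two_mul, ← add_assoc]
    congr 1
    split_ifs with hk
    · rw [count_symm, count_eq_zero_of_lt (by push_cast; omega), Nat.cast_zero]
    · obtain ⟨k, rfl⟩ := Nat.exists_eq_succ_of_ne_zero hk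
      rw [count_symm, foldCount, show n = 1 + (b + 1) + 3 * k by omega]
      push_cast
      congr 2
      ring

end Counting

end Kreweras

namespace Kreweras

/-! ### The functional equation and its restriction to the kernel curve -/

section FunctionalEquation

/-- The generating function of folded walks. -/
noncomputable def serF : ℚ⟦X⟧⟦X⟧⟦X⟧ :=
  PowerSeries.mk fun b => PowerSeries.mk fun a => PowerSeries.mk fun k => foldCount a b k

/-- The generating function of folded walks ending on the line `x = 0` (in terms of `y`). -/
noncomputable def serD : ℚ⟦X⟧⟦X⟧ :=
  PowerSeries.mk fun b => PowerSeries.mk fun k => foldCount 0 b k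

/-- The generating function of folded walks ending on the open half-line `y = 0` (in terms of
`x`). -/
noncomputable def serR : ℚ⟦X⟧⟦X⟧ :=
  PowerSeries.mk fun a => PowerSeries.mk fun k => if a = 0 then 0 else foldCount a 0 k

/-- Coefficient of `x ^ a * y ^ b * s ^ k`. -/
noncomputable def coeff₃ (a b k : ℕ) : ℚ⟦X⟧⟦X⟧⟦X⟧ →+ ℚ where
  toFun f := PowerSeries.coeff k (PowerSeries.coeff a (PowerSeries.coeff b f))
  map_zero' := by simp
  map_add' := by simp

theorem ext_coeff₃ {f g : ℚ⟦X⟧⟦X⟧⟦X⟧} (h : ∀ a b k, coeff₃ a b k f = coeff₃ a b k g) :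
    f = g := by
  ext b a k
  exact h a b k

theorem coeff₃_y_mul (a b k : ℕ) (f : ℚ⟦X⟧⟦X⟧⟦X⟧) :
    coeff₃ a b k (PowerSeries.X * f) = if b = 0 then 0 else coeff₃ a (b - 1) k f := by
  cases b <;> simp [coeff₃, PowerSeries.coeff_succ_X_mul]

theorem coeff₃_x_mul (a b k : ℕ) (f : ℚ⟦X⟧⟦X⟧⟦X⟧) :
    coeff₃ a b k (PowerSeries.C PowerSeries.X * f) = if a = 0 then 0 else coeff₃ (a - 1) b k f := by
  cases a <;> simp [coeff₃, PowerSeries.coeff_C_mul, PowerSeries.coeff_succ_X_mul]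

theorem coeff₃_s_mul (a b k : ℕ) (f : ℚ⟦X⟧⟦X⟧⟦X⟧) :
    coeff₃ a b k (PowerSeries.C (PowerSeries.C PowerSeries.X) * f) =
      if k = 0 then 0 else coeff₃ a b (k - 1) f := by
  cases k <;> simp [coeff₃, PowerSeries.coeff_C_mul, PowerSeries.coeff_succ_X_mul]

theorem coeff₃_one (a b k : ℕ) : coeff₃ a b k 1 = if a = 0 ∧ b = 0 ∧ k = 0 then 1 else 0 := by
  cases a <;> cases b <;> cases k <;> simp [coeff₃, PowerSeries.coeff_one]

theorem coeff₃_serF (a b k : ℕ) : coeff₃ a b k serF = foldCount a b k := by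
  simp [coeff₃, serF]

theorem coeff₃_serD (a b k : ℕ) : coeff₃ a b k (PowerSeries.map PowerSeries.C serD) =
    if a = 0 then foldCount 0 b k else 0 := by
  cases a <;> simp [coeff₃, serD]

theorem coeff₃_serR (a b k : ℕ) : coeff₃ a b k (PowerSeries.C serR) =
    if b = 0 ∧ a ≠ 0 then foldCount a 0 k else 0 := by
  cases b <;> cases a <;> simp [coeff₃, serR]

/-- This is twice the recurrence for `a > 0` plus the recurrence for `a = 0`, multiplied by `x y`;
equivalently `2 (x y (1 - x - y) - s) F = x y (1 + (1 - y) D) - 2 s (D + R)`. Signs and factors 2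
are removed so that each term is a monomial times a series, whose coefficients can be read off. -/
theorem functional_equation :
    let x : ℚ⟦X⟧⟦X⟧⟦X⟧ := PowerSeries.C PowerSeries.X
    let y : ℚ⟦X⟧⟦X⟧⟦X⟧ := PowerSeries.X
    let s : ℚ⟦X⟧⟦X⟧⟦X⟧ := PowerSeries.C (PowerSeries.C PowerSeries.X)
    let D := PowerSeries.map PowerSeries.C serD
    let R := PowerSeries.C serR
    x * (y * serF) + x * (y * serF) + s * D + s * D + s * R + s * R + x * (y * (y * D)) =
      x * (x * (y * serF)) + x * (x * (y * serF)) + x * (y * (y * serF)) + x * (y * (y * serF)) +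
        s * serF + s * serF + x * (y * 1) + x * (y * D) := by
  intro x y s D R
  refine ext_coeff₃ fun a b k => ?_
  simp only [x, y, s, D, R, map_add, coeff₃_x_mul, coeff₃_y_mul, coeff₃_s_mul, coeff₃_one,
    coeff₃_serF, coeff₃_serD, coeff₃_serR]
  -- The factor `x y` shifts the exponents by one, so exponent 1 of `x` is the diagonal and exponent
  -- 0 carries no recurrence.
  rcases a with _ | _ | a
  · rcases b with _ | b
    · rcases k with _ | k
      · simp
      · simp
    · rcases k with _ | k
      · simp
      · simp
  · rcases b with _ | _ | b
    · rcases k with _ | k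
      · simp
      · simp
    · rcases k with _ | k
      · simp
        rw [foldCount_zero 0 0]
        simp
      · simp
        rw [foldCount_zero 0 (k + 1)]
        simp
        ring
    · rcases k with _ | k
      · simp
        rw [foldCount_zero (b + 1) 0]
        simp
      · simp
        rw [foldCount_zero (b + 1) (k + 1)]
        simp
        ring
  · rcases b with _ | _ | b
    · rcases k with _ | k
      · simp
      · simp
    · rcases k with _ | k
      · simp
        rw [foldCount_succ a 0 0]
        simp
      · simp
        rw [foldCount_succ a 0 (k + 1)]
        simp
        ring
    · rcases k with _ | k
      · simp
        rw [foldCount_succ a (b + 1) 0]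
        simp
        ring
      · simp
        rw [foldCount_succ a (b + 1) (k + 1)]
        simp
        ring

/-- The functional equation on the kernel curve. -/
theorem kernel_equation : 1 + evy serD * (xx - zz) = 2 * zz * evx serR := by
  have h := congrArg evxy functional_equation
  simp only [map_add, map_mul, map_one, evxy_X, evxy_C, evx_X, evx_C, ev0_X, evxy_map_C] at h
  -- The coefficient of `F` vanishes on the curve, and `1 - y - 2 z = x - z` is the coefficient of
  -- `D` once `x y` is cancelled.
  refine mul_left_cancel₀ (mul_ne_zero xx_ne_zero yy_ne_zero) ?_
  have hz : zz = 1 - xx - yy := rfl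
  linear_combination -h - (2 * xx * yy * evxy serF - xx * yy * evy serD) * hz

end FunctionalEquation

end Kreweras

namespace Kreweras

/-! ### Polynomial identities on the curve, parametrized by `p` -/

section Identities

variable {R : Type*} [CommRing R]

/-- The left side is `4 (p N(x)) ^ 2`. The right side involves only `p`, `s = x y z` and `e = x y +
y z + z x`, so it is symmetric in `x, y, z`; therefore `N(x) ^ 2 = N(y) ^ 2`. -/
theorem four_mul_sq_on_curve {x y p : R} (hg : 4 * (x * y * (1 - x - y)) * p ^ 3 = p - 1) :
    4 * ((p * y * (1 - x - y) * (1 + 2 * p * x) - x) ^ 2 *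
        (1 - p * (p + 1) * x + p ^ 2 * x ^ 2)) =
      4 * p ^ 2 * (x - x ^ 2 + y * (1 - x - y)) ^ 2
        + (p - 1) * (3 - p) * (x - x ^ 2 + y * (1 - x - y))
        - 3 * p * (p + 3) * (x * y * (1 - x - y)) - (p - 1) := by
  linear_combination (-4 * x ^ 4 * y * p ^ 3 - 4 * x ^ 3 * y ^ 2 * p ^ 3 + 8 * x ^ 3 * y * p ^ 3
    - 4 * x ^ 3 * p + 4 * x ^ 2 * y ^ 2 * p ^ 3 - 4 * x ^ 2 * y * p ^ 3 + 4 * x ^ 2 * y * p ^ 2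
    - x ^ 2 * y * p + 5 * x ^ 2 * p + x ^ 2 + 4 * x * y ^ 2 * p ^ 2 - x * y ^ 2 * p
    - 4 * x * y * p ^ 2 + 2 * x * y * p - 3 * x * y - x * p + 3 * x + y ^ 2 * p - 3 * y ^ 2 - y * p
    + 3 * y - 1) * hg

/-- The square of `x - z` is the discriminant of the kernel at fixed `y`. Up to the square of `p (1
- 2 p y)`, it is `S(y) ^ 2` times a factor symmetric in `x, y, z`. -/
theorem discriminant_on_curve {x y p : R} (hg : 4 * (x * y * (1 - x - y)) * p ^ 3 = p - 1) :
    p ^ 2 * (1 - 2 * p * y) ^ 2 * (x - (1 - x - y)) ^ 2 =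
      (1 - p * (p + 1) * y + p ^ 2 * y ^ 2) *
        (4 * p - 3 - 4 * p ^ 2 * (x - x ^ 2 + y * (1 - x - y))) := by
  linear_combination (-3 * y * p - p + 3) * hg

/-- The product of the two conjugate values of `c' - 2 e ± 2 N`. -/
theorem norm_on_curve {x y p w m : R} (hg : 4 * (x * y * (1 - x - y)) * p ^ 3 = p - 1)
    (hp : p = 1 + 2 * w - 2 * w ^ 2)
    (hm : 4 * m ^ 2 = 4 * p ^ 2 * (x - x ^ 2 + y * (1 - x - y)) ^ 2
        + (p - 1) * (3 - p) * (x - x ^ 2 + y * (1 - x - y))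
        - 3 * p * (p + 3) * (x * y * (1 - x - y)) - (p - 1)) :
    4 * (((1 - w) * (1 + 2 * w + 4 * w ^ 2) - 2 * p ^ 2 * (x - x ^ 2 + y * (1 - x - y))) ^ 2
        - (2 * p * m) ^ 2) =
      4 * ((1 - w) * (1 + w) ^ 3 * (4 * p - 3 - 4 * p ^ 2 * (x - x ^ 2 + y * (1 - x - y)))) := by
  generalize x - x ^ 2 + y * (1 - x - y) = e at *
  generalize x * y * (1 - x - y) = s at *
  -- The terms in `e ^ 2` cancel, and `hg` removes `s`. This identity matches the coefficients of
  -- `e`, and `h2` the constant terms; both rely on `p = 1 + 2 w - 2 w ^ 2`.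
  have h1 : 4 * ((1 - w) * (1 + 2 * w + 4 * w ^ 2)) + (p - 1) * (3 - p) =
      4 * ((1 - w) * (1 + w) ^ 3) := by
    subst hp; ring
  have h2 : 4 * ((1 - w) * (1 + 2 * w + 4 * w ^ 2)) ^ 2 + (p - 1) * (3 * (p + 3) + 4 * p ^ 2) =
      4 * ((1 - w) * (1 + w) ^ 3 * (4 * p - 3)) := by
    subst hp; ring
  linear_combination -4 * p ^ 2 * hm + h2 - 4 * p ^ 2 * e * h1 + 3 * (p + 3) * hg

end Identities

/-! ### Square roots of power series -/

section SquareRoot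

variable {R : Type*} [CommRing R]

/-- A power series whose constant coefficient is the square of a unit `r` has a square root with
constant coefficient `r`. -/
theorem exists_sq_eq {q : R} (hq : 4 * q = 1) {r r' : R} (hr : r * r' = 1) {f : R⟦X⟧}
    (hf : PowerSeries.constantCoeff f = r ^ 2) :
    ∃ g : R⟦X⟧, g ^ 2 = f ∧ PowerSeries.constantCoeff g = r := by
  set u : R⟦X⟧ := PowerSeries.C q * (1 - PowerSeries.C (r' ^ 2) * f) with hu
  have hu0 : PowerSeries.constantCoeff u = 0 := by
    simp only [hu, map_mul, map_sub, PowerSeries.constantCoeff_C, map_one, hf]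
    linear_combination (-q * (1 + r * r')) * hr
  have hs : PowerSeries.HasSubst u := PowerSeries.HasSubst.of_constantCoeff_zero' hu0
  -- The Catalan series `c(u)` satisfies `c = 1 + u c ^ 2`, so `1 - 2 u c(u)` is the square root of
  -- `1 - 4 u`; here `1 - 4 u = f / r ^ 2`.
  set k : R⟦X⟧ := PowerSeries.map (Nat.castRingHom R) PowerSeries.catalanSeries with hk
  have hk1 : k ^ 2 * PowerSeries.X + 1 = k := by
    have := congrArg (PowerSeries.map (Nat.castRingHom R))
      PowerSeries.catalanSeries_sq_mul_X_add_one
    simpa using this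
  have hc : (PowerSeries.substAlgHom (R := R) hs k) ^ 2 * u + 1 =
      PowerSeries.substAlgHom (R := R) hs k := by
    have := congrArg (PowerSeries.substAlgHom (R := R) hs) hk1
    simpa [PowerSeries.substAlgHom_X] using this
  set c := PowerSeries.substAlgHom (R := R) hs k
  have h4 : 4 * u = 1 - PowerSeries.C (r' ^ 2) * f := by
    have : (4 : R⟦X⟧) * PowerSeries.C q = 1 := by
      rw [show (4 : R⟦X⟧) = PowerSeries.C (4 : R) from (map_ofNat PowerSeries.C 4).symm, ← map_mul,
        hq, map_one]
    rw [hu, ← mul_assoc, this, one_mul]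
  have hrr : PowerSeries.C r * PowerSeries.C r' = 1 := by rw [← map_mul, hr, map_one]
  refine ⟨PowerSeries.C r * (1 - 2 * u * c), ?_, ?_⟩
  · rw [map_pow] at h4
    clear_value u
    linear_combination (4 * PowerSeries.C r ^ 2 * u) * hc - PowerSeries.C r ^ 2 * h4
      + (f * (PowerSeries.C r * PowerSeries.C r' + 1)) * hrr
  · simp [hu0]

end SquareRoot

/-! ### The series `V ^ 3`, `W`, `Z` as series in `s` -/

section BaseSeries

theorem four_mul_C_inv : (4 : ℚ⟦X⟧) * PowerSeries.C (1 / 4 : ℚ) = 1 := by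
  rw [show (4 : ℚ⟦X⟧) = PowerSeries.C (4 : ℚ) from (map_ofNat PowerSeries.C 4).symm, ← map_mul]
  norm_num

theorem exists_serU : ∃ U : ℚ⟦X⟧, PowerSeries.X ∣ U ∧ 4 * PowerSeries.X * (1 + U) ^ 3 = U := by
  obtain ⟨U, hU, -⟩ := existsUnique_fixedPoint (fun f => 4 * PowerSeries.X * (1 + f) ^ 3)
    (fun f _ => ⟨4 * (1 + f) ^ 3, by ring⟩) (by
      rintro f g n - - ⟨c, hc⟩
      refine ⟨4 * c * ((1 + f) ^ 2 + (1 + f) * (1 + g) + (1 + g) ^ 2), ?_⟩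
      linear_combination
        (4 * PowerSeries.X * ((1 + f) ^ 2 + (1 + f) * (1 + g) + (1 + g) ^ 2)) * hc)
  exact ⟨U, hU⟩

/-- The series `V ^ 3 / 2` in terms of `s = t ^ 3`. -/
noncomputable def serU : ℚ⟦X⟧ := exists_serU.choose

theorem exists_serWs : ∃ f : ℚ⟦X⟧, PowerSeries.X ∣ f ∧
    f ^ 2 + PowerSeries.C (1 / 4 : ℚ) * (2 * serU) = f := by
  obtain ⟨c, hc⟩ := exists_serU.choose_spec.1
  obtain ⟨f, hf, -⟩ := existsUnique_fixedPoint
    (fun f => f ^ 2 + PowerSeries.C (1 / 4 : ℚ) * (2 * serU))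
    (fun f hf => dvd_add (dvd_pow hf two_ne_zero)
      (Dvd.dvd.mul_left (Dvd.dvd.mul_left ⟨c, hc⟩ _) _)) (by
      rintro f g n ⟨a, ha⟩ ⟨b, hb⟩ ⟨c, hc⟩
      refine ⟨c * (a + b), ?_⟩
      have h : f + g = PowerSeries.X * (a + b) := by rw [ha, hb]; ring
      linear_combination (f + g) * hc + (PowerSeries.X ^ n * c) * h)
  exact ⟨f, hf⟩

/-- The series `W` in terms of `s = t ^ 3`. -/
noncomputable def serWs : ℚ⟦X⟧ := exists_serWs.choose

theorem exists_serZs : ∃ f : ℚ⟦X⟧, PowerSeries.X ∣ f ∧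
    serWs * (2 * PowerSeries.C (1 / 4 : ℚ) * (1 + f ^ 2)) = f := by
  obtain ⟨d, hd⟩ : PowerSeries.X ∣ serWs := exists_serWs.choose_spec.1
  obtain ⟨f, hf, -⟩ := existsUnique_fixedPoint
    (fun f => serWs * (2 * PowerSeries.C (1 / 4 : ℚ) * (1 + f ^ 2)))
    (fun f _ => Dvd.dvd.mul_right ⟨d, hd⟩ _) (by
      rintro f g n - - ⟨c, hc⟩
      refine ⟨c * (f + g) * d * (2 * PowerSeries.C (1 / 4 : ℚ)), ?_⟩
      simp only [hd]
      linear_combination (PowerSeries.X * d * (2 * PowerSeries.C (1 / 4 : ℚ)) * (f + g)) * hc)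
  exact ⟨f, hf⟩

/-- The series `Z` in terms of `s = t ^ 3`. -/
noncomputable def serZs : ℚ⟦X⟧ := exists_serZs.choose

theorem constantCoeff_serU : PowerSeries.constantCoeff serU = 0 :=
  PowerSeries.X_dvd_iff.1 exists_serU.choose_spec.1

theorem constantCoeff_serWs : PowerSeries.constantCoeff serWs = 0 :=
  PowerSeries.X_dvd_iff.1 exists_serWs.choose_spec.1

theorem constantCoeff_serZs : PowerSeries.constantCoeff serZs = 0 :=
  PowerSeries.X_dvd_iff.1 exists_serZs.choose_spec.1

/-- The series `1 + V ^ 3 / 2` in terms of `s = t ^ 3`. -/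
noncomputable def serP : ℚ⟦X⟧ := 1 + serU

theorem serP_eq : 4 * PowerSeries.X * serP ^ 3 = serP - 1 := by
  have : 4 * PowerSeries.X * (1 + serU) ^ 3 = serU := exists_serU.choose_spec.2
  rw [serP, this]
  ring

theorem serP_eq_serWs : serP = 1 + 2 * serWs - 2 * serWs ^ 2 := by
  have : serWs ^ 2 + PowerSeries.C (1 / 4 : ℚ) * (2 * serU) = serWs := exists_serWs.choose_spec.2
  rw [serP]
  linear_combination (2 : ℚ⟦X⟧) * this - serU * four_mul_C_inv

theorem serZs_eq : 2 * serZs = serWs * (1 + serZs ^ 2) := by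
  have : serWs * (2 * PowerSeries.C (1 / 4 : ℚ) * (1 + serZs ^ 2)) = serZs :=
    exists_serZs.choose_spec.2
  linear_combination (-2 : ℚ⟦X⟧) * this + serWs * (1 + serZs ^ 2) * four_mul_C_inv

theorem constantCoeff_serP : PowerSeries.constantCoeff serP = 1 := by
  simp [serP, constantCoeff_serU]

theorem serP_mul_inv : serP * serP⁻¹ = 1 :=
  PowerSeries.mul_inv_cancel _ (by simp [constantCoeff_serP])

theorem one_add_serZs_sq_mul_inv : (1 + serZs ^ 2) * (1 + serZs ^ 2)⁻¹ = 1 :=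
  PowerSeries.mul_inv_cancel _ (by simp [constantCoeff_serZs])

/-- The value at `x = 0` of the series `serB` below. -/
noncomputable def serr : ℚ⟦X⟧ :=
  (1 + serWs) * (1 - serZs ^ 2) * ((1 + serZs ^ 2)⁻¹ * serP⁻¹)

theorem constantCoeff_serr : PowerSeries.constantCoeff serr = 1 := by
  simp [serr, constantCoeff_serP, constantCoeff_serWs, constantCoeff_serZs]

theorem serr_mul_inv : serr * serr⁻¹ = 1 :=
  PowerSeries.mul_inv_cancel _ (by simp [constantCoeff_serr])

/-- The relation `2 Z = W (1 + Z ^ 2)` makes `(1 - Z ^ 2) / (1 + Z ^ 2)` the square root of `1 - W ^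
2`, so `r ^ 2` is rational in `W` although `r` is defined through `Z`. -/
theorem serr_sq : serP ^ 2 * serr ^ 2 = (1 - serWs) * (1 + serWs) ^ 3 := by
  have h1 := serP_mul_inv
  have h2 := one_add_serZs_sq_mul_inv
  have h3 := serZs_eq
  have h4 : serP * serr = (1 + serWs) * (1 - serZs ^ 2) * (1 + serZs ^ 2)⁻¹ := by
    rw [serr]
    linear_combination ((1 + serWs) * (1 - serZs ^ 2) * (1 + serZs ^ 2)⁻¹) * h1
  have h5 : (1 - serZs ^ 2) ^ 2 = (1 - serWs ^ 2) * (1 + serZs ^ 2) ^ 2 := by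
    linear_combination (-(2 * serZs + serWs * (1 + serZs ^ 2))) * h3
  calc serP ^ 2 * serr ^ 2 = (serP * serr) ^ 2 := by ring
    _ = (1 + serWs) ^ 2 * (1 - serZs ^ 2) ^ 2 * (1 + serZs ^ 2)⁻¹ ^ 2 := by rw [h4]; ring
    _ = (1 + serWs) ^ 2 * (1 - serWs ^ 2) * ((1 + serZs ^ 2) * (1 + serZs ^ 2)⁻¹) ^ 2 := by
      rw [h5]; ring
    _ = _ := by rw [h2]; ring

end BaseSeries

end Kreweras

namespace Kreweras

/-! ### The explicit solution of the kernel equation -/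

section Solution

theorem exists_serS : ∃ S : ℚ⟦X⟧⟦X⟧,
    S ^ 2 = 1 - PowerSeries.C (serP * (serP + 1)) * PowerSeries.X +
      PowerSeries.C (serP ^ 2) * PowerSeries.X ^ 2 ∧ PowerSeries.constantCoeff S = 1 :=
  exists_sq_eq four_mul_C_inv (mul_one (1 : ℚ⟦X⟧)) (by simp)

/-- The square root of the polynomial `1 - p (p + 1) x + p ^ 2 x ^ 2`. -/
noncomputable def serS : ℚ⟦X⟧⟦X⟧ := exists_serS.choose

theorem serS_sq : serS ^ 2 = 1 - PowerSeries.C (serP * (serP + 1)) * PowerSeries.X +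
    PowerSeries.C (serP ^ 2) * PowerSeries.X ^ 2 := exists_serS.choose_spec.1

theorem constantCoeff_serS : PowerSeries.constantCoeff serS = 1 := exists_serS.choose_spec.2

theorem constantCoeff_sq {R : Type*} [CommRing R] (f : R⟦X⟧) :
    PowerSeries.coeff 1 (f ^ 2) =
      2 * (PowerSeries.constantCoeff f * PowerSeries.coeff 1 f) := by
  rw [sq, PowerSeries.coeff_mul, Finset.Nat.antidiagonal_succ]
  simp
  ring

theorem two_mul_coeff_one_serS : 2 * PowerSeries.coeff 1 serS = -(serP * (serP + 1)) := by
  have h := congrArg (PowerSeries.coeff 1) serS_sq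
  rw [constantCoeff_sq, constantCoeff_serS, one_mul] at h
  rw [h, map_add, map_sub, PowerSeries.coeff_C_mul, PowerSeries.coeff_C_mul]
  simp [PowerSeries.coeff_one, PowerSeries.coeff_X_pow]

theorem coeff_one_X_mul {R : Type*} [CommRing R] (f : R⟦X⟧) :
    PowerSeries.coeff 1 (PowerSeries.X * f) = PowerSeries.constantCoeff f := by
  rw [← zero_add 1, PowerSeries.coeff_succ_X_mul, PowerSeries.coeff_zero_eq_constantCoeff_apply]

/-- The constant term of the invariant. -/
noncomputable def serc : ℚ⟦X⟧ := (1 - serWs) * (1 + 2 * serWs + 4 * serWs ^ 2) * serP⁻¹ ^ 2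

/-- The series `x I(x)`, for `I` the invariant `c' - 2 e + 2 N`. -/
noncomputable def serI : ℚ⟦X⟧⟦X⟧ :=
  PowerSeries.C serc * PowerSeries.X
    - 2 * (PowerSeries.X ^ 2 - PowerSeries.X ^ 3 + PowerSeries.C PowerSeries.X)
    + 2 * (PowerSeries.C PowerSeries.X * (1 + 2 * PowerSeries.C serP * PowerSeries.X)
      - PowerSeries.C serP⁻¹ * PowerSeries.X ^ 2) * serS

theorem constantCoeff_serI : PowerSeries.constantCoeff serI = 0 := by
  simp [serI, constantCoeff_serS]

/-- This is the value at `x = 0` of the invariant `I`. That it is the square of the unit `r` allows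
the extraction of the square root `B`. -/
theorem coeff_one_serI : PowerSeries.coeff 1 serI = serr ^ 2 := by
  have h1 : PowerSeries.coeff 1 serI =
      serc + 4 * PowerSeries.X * serP + 2 * PowerSeries.X * PowerSeries.coeff 1 serS := by
    have h : serI = PowerSeries.X * (PowerSeries.C (serc + 4 * PowerSeries.X * serP) * 1)
        + (PowerSeries.X * (PowerSeries.X * (2 * PowerSeries.X - 2))
          - PowerSeries.C (2 * PowerSeries.X) * 1
          + PowerSeries.C (2 * PowerSeries.X) * serS
          + PowerSeries.X * (PowerSeries.C (4 * PowerSeries.X * serP) * (serS - 1))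
          - PowerSeries.X * (PowerSeries.X * (2 * PowerSeries.C serP⁻¹ * serS))) := by
      simp only [serI, map_add, map_mul, map_ofNat]
      ring
    rw [h]
    simp only [map_add, map_sub, PowerSeries.coeff_C_mul, coeff_one_X_mul]
    simp [constantCoeff_serS, PowerSeries.coeff_one]
  rw [h1]
  have h2 := two_mul_coeff_one_serS
  have h3 := serP_mul_inv
  have h4 := serP_eq
  have h5 := serP_eq_serWs
  have h6 := serr_sq
  have h7 : serP ^ 2 * serc = (1 - serWs) * (1 + 2 * serWs + 4 * serWs ^ 2) := by
    rw [serc]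
    linear_combination ((1 - serWs) * (1 + 2 * serWs + 4 * serWs ^ 2) *
      (serP * serP⁻¹ + 1)) * h3
  have h0 : (4 : ℚ⟦X⟧) * serP ^ 2 ≠ 0 := fun h => by
    have := congrArg PowerSeries.constantCoeff h
    rw [map_mul, map_ofNat, map_pow, constantCoeff_serP, map_zero] at this
    norm_num at this
  refine mul_left_cancel₀ h0 ?_
  have h8 : 4 * ((1 - serWs) * (1 + 2 * serWs + 4 * serWs ^ 2)) + (serP - 1) * (3 - serP) =
      4 * ((1 - serWs) * (1 + serWs) ^ 3) := by
    rw [h5]; ring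
  linear_combination 4 * h7 + (4 * serP ^ 2 * PowerSeries.X) * h2 + (3 - serP) * h4 - 4 * h6 + h8

theorem exists_serB : ∃ B : ℚ⟦X⟧⟦X⟧, PowerSeries.X * B ^ 2 = serI ∧
    PowerSeries.constantCoeff B = serr := by
  obtain ⟨g, hg⟩ := PowerSeries.X_dvd_iff.2 constantCoeff_serI
  have hg0 : PowerSeries.constantCoeff g = serr ^ 2 := by
    rw [← coeff_one_serI, hg, coeff_one_X_mul]
  obtain ⟨B, hB, hB0⟩ := exists_sq_eq four_mul_C_inv serr_mul_inv hg0
  exact ⟨B, by rw [hB, hg], hB0⟩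

/-- The square root of the invariant. -/
noncomputable def serB : ℚ⟦X⟧⟦X⟧ := exists_serB.choose

theorem serB_sq : PowerSeries.X * serB ^ 2 = serI := exists_serB.choose_spec.1

theorem constantCoeff_serB : PowerSeries.constantCoeff serB = serr := exists_serB.choose_spec.2

theorem constantCoeff_serS_mul_serB : PowerSeries.constantCoeff (serB * serS) = serr := by
  rw [map_mul, constantCoeff_serB, constantCoeff_serS, mul_one]

/-- The product `B S` is a unit, its constant term being `r`. The formula is suggested by `A(y) ^ 2
(x - z) ^ 2 = B(x) ^ 2`: after multiplication by `B(y) ^ 2 S(y) ^ 2`, `norm_on_curve` and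
`discriminant_on_curve` turn this into an equation for `(A B S) ^ 2` at `y`. -/
theorem exists_serA : ∃ A : ℚ⟦X⟧⟦X⟧,
    A * (serB * serS) = PowerSeries.C serr * (1 - 2 * PowerSeries.C serP * PowerSeries.X) := by
  have hr : IsUnit serr := IsUnit.of_mul_eq_one _ serr_mul_inv
  obtain ⟨v, hv⟩ : IsUnit (serB * serS) := by
    rw [PowerSeries.isUnit_iff_constantCoeff, constantCoeff_serS_mul_serB]
    exact hr
  refine ⟨PowerSeries.C serr * (1 - 2 * PowerSeries.C serP * PowerSeries.X) *
    ((v⁻¹ : ℚ⟦X⟧⟦X⟧ˣ) : ℚ⟦X⟧⟦X⟧), ?_⟩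
  rw [← hv, mul_assoc, Units.inv_mul, mul_one]

/-- The series `1 + y D(y)`, where `D` counts walks ending on the diagonal. -/
noncomputable def serA : ℚ⟦X⟧⟦X⟧ := exists_serA.choose

theorem serA_mul : serA * (serB * serS) =
    PowerSeries.C serr * (1 - 2 * PowerSeries.C serP * PowerSeries.X) := exists_serA.choose_spec

theorem serr_ne_zero : serr ≠ 0 := fun h => by
  have := constantCoeff_serr
  simp [h] at this

theorem constantCoeff_serA : PowerSeries.constantCoeff serA = 1 := by
  have h := congrArg PowerSeries.constantCoeff serA_mul
  rw [map_mul, constantCoeff_serS_mul_serB] at h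
  simp only [map_mul, map_sub, map_one, PowerSeries.constantCoeff_C, PowerSeries.constantCoeff_X,
    mul_zero, sub_zero, mul_one] at h
  exact mul_right_cancel₀ serr_ne_zero (h.trans (one_mul _).symm)

theorem map_constantCoeff_C (f : ℚ⟦X⟧) :
    PowerSeries.map PowerSeries.constantCoeff (PowerSeries.C f) =
      PowerSeries.C (PowerSeries.constantCoeff f) := PowerSeries.map_C _ _

/-- At `s = 0`, the series `serS` is `1 - x`. -/
theorem map_constantCoeff_serS :
    PowerSeries.map PowerSeries.constantCoeff serS = 1 - PowerSeries.X := by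
  have h := congrArg (PowerSeries.map PowerSeries.constantCoeff) serS_sq
  simp only [map_add, map_sub, map_mul, map_pow, map_one, map_constantCoeff_C,
    PowerSeries.map_X, constantCoeff_serP] at h
  have h0 : PowerSeries.constantCoeff (PowerSeries.map PowerSeries.constantCoeff serS) = 1 := by
    rw [← PowerSeries.coeff_zero_eq_constantCoeff_apply, PowerSeries.coeff_map,
      PowerSeries.coeff_zero_eq_constantCoeff_apply, constantCoeff_serS, map_one]
  have h2 : PowerSeries.map PowerSeries.constantCoeff serS ^ 2 = (1 - PowerSeries.X) ^ 2 := by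
    linear_combination h
  rcases sq_eq_sq_iff_eq_or_eq_neg.1 h2 with h3 | h3
  · exact h3
  · rw [h3] at h0
    norm_num at h0

/-- At `s = 0`, the series `serB` is `1 - 2 x`. -/
theorem map_constantCoeff_serB :
    PowerSeries.map PowerSeries.constantCoeff serB = 1 - 2 * PowerSeries.X := by
  have h := congrArg (PowerSeries.map PowerSeries.constantCoeff) serB_sq
  have hc : PowerSeries.constantCoeff serc = 1 := by
    simp [serc, constantCoeff_serWs, constantCoeff_serP]
  have hp : PowerSeries.constantCoeff serP⁻¹ = 1 := by
    simp [constantCoeff_serP]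
  simp only [serI, map_add, map_sub, map_mul, map_pow, map_one, map_constantCoeff_C, hc, hp,
    PowerSeries.map_X, constantCoeff_serP, PowerSeries.constantCoeff_X, map_constantCoeff_serS,
    map_zero, map_ofNat] at h
  have h0 : PowerSeries.constantCoeff (PowerSeries.map PowerSeries.constantCoeff serB) = 1 := by
    rw [← PowerSeries.coeff_zero_eq_constantCoeff_apply, PowerSeries.coeff_map,
      PowerSeries.coeff_zero_eq_constantCoeff_apply, constantCoeff_serB, constantCoeff_serr]
  have h2 : PowerSeries.map PowerSeries.constantCoeff serB ^ 2 = (1 - 2 * PowerSeries.X) ^ 2 := by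
    refine mul_left_cancel₀ PowerSeries.X_ne_zero ?_
    linear_combination h
  rcases sq_eq_sq_iff_eq_or_eq_neg.1 h2 with h3 | h3
  · exact h3
  · rw [h3] at h0
    norm_num at h0

/-- The abscissa of the curve in the parametrization by `p`. -/
theorem evaluated_serP : 4 * (xx * yy * (1 - xx - yy)) * ev0 serP ^ 3 = ev0 serP - 1 := by
  have h := congrArg ev0 serP_eq
  simp only [map_mul, map_ofNat, ev0_X, map_pow, map_sub, map_one] at h
  exact h

theorem evx_serS_sq : evx serS ^ 2 =
    1 - ev0 serP * (ev0 serP + 1) * xx + ev0 serP ^ 2 * xx ^ 2 := by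
  have h := congrArg evx serS_sq
  simpa only [map_mul, evx_X, evx_C, map_pow, map_sub, map_add, map_one] using h

theorem evy_serS_sq : evy serS ^ 2 =
    1 - ev0 serP * (ev0 serP + 1) * yy + ev0 serP ^ 2 * yy ^ 2 := by
  have h := congrArg evy serS_sq
  simpa only [map_mul, evy_X, evy_C, map_pow, map_sub, map_add, map_one] using h

theorem pl_ofNat_ne_zero (n : ℕ) [n.AtLeastTwo] : (OfNat.ofNat n : Pl) ≠ 0 := fun h => by
  have := congrArg MvPowerSeries.constantCoeff h
  rw [map_ofNat, map_zero] at this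
  exact OfNat.ofNat_ne_zero n this

/-- The series `N`, up to a factor, takes opposite values at `x` and `y`. -/
theorem evx_eq_neg_evy :
    (ev0 serP * yy * zz * (1 + 2 * ev0 serP * xx) - xx) * evx serS =
      -((ev0 serP * xx * zz * (1 + 2 * ev0 serP * yy) - yy) * evy serS) := by
  have hg := evaluated_serP
  have h1 := four_mul_sq_on_curve hg
  have h2 := four_mul_sq_on_curve (x := yy) (y := xx) (p := ev0 serP) (by linear_combination hg)
  rw [← evx_serS_sq] at h1
  rw [← evy_serS_sq] at h2
  have hsq : ((ev0 serP * yy * zz * (1 + 2 * ev0 serP * xx) - xx) * evx serS) ^ 2 =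
      ((ev0 serP * xx * zz * (1 + 2 * ev0 serP * yy) - yy) * evy serS) ^ 2 := by
    refine mul_left_cancel₀ (pl_ofNat_ne_zero 4) ?_
    rw [zz]
    linear_combination h1 - h2
  refine (sq_eq_sq_iff_eq_or_eq_neg.1 hsq).resolve_left fun h => ?_
  -- The sign is decided on `x = 0`, where the two sides of `h` become `y (1 - y)` and `-y (1 - y)`.
  have h3 := congrArg resx h
  simp only [map_mul, map_sub, map_add, map_one, map_ofNat, resx_xx, resx_yy, resx_ev0,
    resx_evx, resx_evy, constantCoeff_serP, constantCoeff_serS, map_constantCoeff_serS, zz] at h3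
  have h4 : (2 : ℚ⟦X⟧) * (PowerSeries.X * (1 - PowerSeries.X)) = 0 := by
    linear_combination h3
  have h5 := (mul_eq_zero.1 ((mul_eq_zero.1 h4).resolve_left powerSeries_two_ne_zero)).resolve_left
    PowerSeries.X_ne_zero
  have h6 := congrArg PowerSeries.constantCoeff h5
  simp at h6

theorem ev0_serP_mul_inv : ev0 serP * ev0 serP⁻¹ = 1 := by
  rw [← map_mul, serP_mul_inv, map_one]

theorem ev0_serP_ne_zero : ev0 serP ≠ 0 := left_ne_zero_of_mul_eq_one ev0_serP_mul_inv

/-- On the curve `s / x = y z`, so the equation for `x B ^ 2` can be divided by `x`. The first terms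
are symmetric in `x` and `y`; only the last one, `2 p ^ 2 N`, changes sign in `evy_serB_sq`. -/
theorem evx_serB_sq : ev0 serP ^ 2 * evx serB ^ 2 =
    (1 - ev0 serWs) * (1 + 2 * ev0 serWs + 4 * ev0 serWs ^ 2)
      - 2 * ev0 serP ^ 2 * (xx - xx ^ 2 + yy * (1 - xx - yy))
      + 2 * ev0 serP *
        ((ev0 serP * yy * zz * (1 + 2 * ev0 serP * xx) - xx) * evx serS) := by
  have h := congrArg evx serB_sq
  simp only [serI, serc, map_mul, evx_X, evx_C, map_pow, map_sub, map_add, map_one, map_ofNat,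
    ev0_X] at h
  refine mul_left_cancel₀ xx_ne_zero ?_
  have hp := ev0_serP_mul_inv
  have hz : zz = 1 - xx - yy := rfl
  linear_combination ev0 serP ^ 2 * h + (xx * ((1 - ev0 serWs) *
    (1 + 2 * ev0 serWs + 4 * ev0 serWs ^ 2)) * (ev0 serP * ev0 serP⁻¹ + 1)
    - 2 * ev0 serP * xx ^ 2 * evx serS) * hp - 2 * ev0 serP ^ 2 * xx * yy * hz

theorem evy_serB_sq : ev0 serP ^ 2 * evy serB ^ 2 =
    (1 - ev0 serWs) * (1 + 2 * ev0 serWs + 4 * ev0 serWs ^ 2)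
      - 2 * ev0 serP ^ 2 * (xx - xx ^ 2 + yy * (1 - xx - yy))
      + 2 * ev0 serP *
        ((ev0 serP * xx * zz * (1 + 2 * ev0 serP * yy) - yy) * evy serS) := by
  have h := congrArg evy serB_sq
  simp only [serI, serc, map_mul, evy_X, evy_C, map_pow, map_sub, map_add, map_one, map_ofNat,
    ev0_X] at h
  refine mul_left_cancel₀ yy_ne_zero ?_
  have hp := ev0_serP_mul_inv
  have hz : zz = 1 - xx - yy := rfl
  linear_combination ev0 serP ^ 2 * h + (yy * ((1 - ev0 serWs) *
    (1 + 2 * ev0 serWs + 4 * ev0 serWs ^ 2)) * (ev0 serP * ev0 serP⁻¹ + 1)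
    - 2 * ev0 serP * yy ^ 2 * evy serS) * hp - 2 * ev0 serP ^ 2 * xx * yy * hz

theorem constantCoeff_evx_serB : MvPowerSeries.constantCoeff (evx serB) = 1 := by
  rw [constantCoeff_evx, constantCoeff_serB, constantCoeff_serr]

theorem constantCoeff_evy_serB : MvPowerSeries.constantCoeff (evy serB) = 1 := by
  rw [constantCoeff_evy, constantCoeff_serB, constantCoeff_serr]

theorem constantCoeff_evy_serS : MvPowerSeries.constantCoeff (evy serS) = 1 := by
  rw [constantCoeff_evy, constantCoeff_serS, map_one]

theorem constantCoeff_evy_serA : MvPowerSeries.constantCoeff (evy serA) = 1 := by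
  rw [constantCoeff_evy, constantCoeff_serA, map_one]

theorem evy_serA_mul : evy serA * (evy serB * evy serS) =
    ev0 serr * (1 - 2 * ev0 serP * yy) := by
  have h := congrArg evy serA_mul
  simpa only [map_mul, map_sub, map_one, map_ofNat, evy_C, evy_X] using h

/-- The factorization of the kernel equation. -/
theorem evy_serA_mul_sub : evy serA * (xx - zz) = -evx serB := by
  have hg := evaluated_serP
  have hN := evx_eq_neg_evy
  have hx := evx_serB_sq
  have hy := evy_serB_sq
  have h1 := four_mul_sq_on_curve hg
  rw [← evx_serS_sq] at h1
  have hp : ev0 serP = 1 + 2 * ev0 serWs - 2 * ev0 serWs ^ 2 := by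
    have := congrArg ev0 serP_eq_serWs
    simpa only [map_mul, map_sub, map_add, map_one, map_ofNat, map_pow] using this
  have hr : ev0 serP ^ 2 * ev0 serr ^ 2 = (1 - ev0 serWs) * (1 + ev0 serWs) ^ 3 := by
    have := congrArg ev0 serr_sq
    simpa only [map_mul, map_sub, map_add, map_one, map_ofNat, map_pow] using this
  have hn := norm_on_curve (m := (ev0 serP * yy * zz * (1 + 2 * ev0 serP * xx) - xx) * evx serS)
    hg hp (by rw [zz]; linear_combination h1)
  have hd := discriminant_on_curve hg
  rw [← evy_serS_sq] at hd
  have ha := evy_serA_mul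
  have hbs : evy serB * evy serS ≠ 0 := fun h => by
    have := congrArg MvPowerSeries.constantCoeff h
    rw [map_mul, constantCoeff_evy_serB, constantCoeff_evy_serS] at this
    simp at this
  generalize hm : (ev0 serP * yy * zz * (1 + 2 * ev0 serP * xx) - xx) * evx serS = m at *
  generalize hm' : (ev0 serP * xx * zz * (1 + 2 * ev0 serP * yy) - yy) * evy serS = m' at *
  -- Both sides are multiplied by `4 p ^ 4 B(y) ^ 2 S(y) ^ 2`. The left side then follows from the
  -- formula for `A` and the discriminant identity, the right side from the norm identity, in which
  -- `N(y) = - N(x)` turns `B(x) ^ 2 B(y) ^ 2` into a difference of squares.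
  have hsq : (evy serA * (xx - zz)) ^ 2 = evx serB ^ 2 := by
    have h2 : 4 * (ev0 serP ^ 2 * evx serB ^ 2 * (ev0 serP ^ 2 * evy serB ^ 2)) =
        4 * (ev0 serP ^ 2 * ev0 serr ^ 2 * (4 * ev0 serP - 3 - 4 * ev0 serP ^ 2 *
          (xx - xx ^ 2 + yy * (1 - xx - yy)))) := by
      rw [hx, hy, hr, ← hn, hN]
      ring
    refine mul_left_cancel₀ (mul_ne_zero (mul_ne_zero (pl_ofNat_ne_zero 4)
      (pow_ne_zero 4 ev0_serP_ne_zero)) (pow_ne_zero 2 hbs)) ?_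
    calc _ = 4 * ev0 serP ^ 4 * (evy serA * (evy serB * evy serS)) ^ 2 * (xx - zz) ^ 2 := by ring
      _ = 4 * ev0 serP ^ 2 * ev0 serr ^ 2 * (ev0 serP ^ 2 * (1 - 2 * ev0 serP * yy) ^ 2 *
          (xx - (1 - xx - yy)) ^ 2) := by rw [ha, zz]; ring
      _ = evy serS ^ 2 * (4 * (ev0 serP ^ 2 * ev0 serr ^ 2 * (4 * ev0 serP - 3 - 4 * ev0 serP ^ 2 *
          (xx - xx ^ 2 + yy * (1 - xx - yy))))) := by rw [hd]; ring
      _ = _ := by rw [← h2]; ring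
  refine (sq_eq_sq_iff_eq_or_eq_neg.1 hsq).resolve_left fun h => ?_
  -- At the origin `A (x - z)` is `-1` and `B` is `1`, which excludes the positive sign.
  have := congrArg MvPowerSeries.constantCoeff h
  rw [map_mul, map_sub, constantCoeff_evy_serA, constantCoeff_evx_serB, constantCoeff_xx,
    constantCoeff_zz] at this
  norm_num at this

/-- The solution of the kernel equation. -/
theorem serD_serR_eq : serA = 1 + PowerSeries.X * serD ∧
    2 * PowerSeries.C PowerSeries.X * serR = PowerSeries.X * (1 - 2 * PowerSeries.X - serB) := by
  obtain ⟨D, hD⟩ : PowerSeries.X ∣ serA - 1 := PowerSeries.X_dvd_iff.2 (by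
    rw [map_sub, constantCoeff_serA, map_one, sub_self])
  -- Since `B = 1 - 2 x` at `s = 0`, the candidate for the walks ending at `b = 0` has no
  -- denominator `s`.
  obtain ⟨R, hR⟩ := exists_eq_C_X_mul (f := 1 - 2 * PowerSeries.X - serB) (by
    rw [map_sub, map_sub, map_mul, map_one, map_ofNat, PowerSeries.map_X, map_constantCoeff_serB,
      sub_self])
  have h4 : (4 : ℚ⟦X⟧⟦X⟧) * PowerSeries.C (PowerSeries.C (1 / 4 : ℚ)) = 1 := by
    have := congrArg PowerSeries.C four_mul_C_inv
    rwa [map_mul, map_ofNat, map_one] at this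
  -- The constant `q` is `1 / 2`.
  set q : ℚ⟦X⟧⟦X⟧ := 2 * PowerSeries.C (PowerSeries.C (1 / 4 : ℚ)) with hq
  have hq2 : 2 * q = 1 := by rw [hq]; linear_combination h4
  clear_value q
  have hk : 1 + evy D * (xx - zz) = 2 * zz * evx (q * (PowerSeries.X * R)) := by
    have h1 := congrArg evy hD
    have h2 := congrArg evx hR
    have h3 := congrArg evx hq2
    simp only [map_mul, map_sub, map_one, map_ofNat, evy_X, evx_X, evx_C, ev0_X] at h1 h2 h3 ⊢
    have h5 := evy_serA_mul_sub
    have hz : zz = 1 - xx - yy := rfl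
    refine mul_left_cancel₀ yy_ne_zero ?_
    linear_combination (-(xx - zz)) * h1 + h2 + h5 + hz - (xx * yy * zz * evx R) * h3
  have hk' := kernel_equation
  -- The candidates and the generating functions solve the same linear equation, and both candidates
  -- for `R` vanish at `x = 0`, so uniqueness applies to the differences.
  have := eq_zero_of_curve (D := serD - D) (R := serR - q * (PowerSeries.X * R)) (by
      simp [serR]
      rfl) (by
      rw [map_sub, map_sub]
      linear_combination hk' - hk)
  have h6 := sub_eq_zero.1 this.1
  have h7 := sub_eq_zero.1 this.2
  refine ⟨?_, ?_⟩
  · rw [h6]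
    linear_combination hD
  · rw [h7, hR]
    linear_combination (PowerSeries.C PowerSeries.X * PowerSeries.X * R) * hq2

end Solution

end Kreweras

namespace Kreweras

/-! ### From series in `s` to Laurent series in `t`, with `s = t ^ 3` -/

section Theta

theorem laurentSeries_ofNat_ne_zero (n : ℕ) [n.AtLeastTwo] :
    (OfNat.ofNat n : LaurentSeries ℚ) ≠ 0 := by
  have : CharZero (LaurentSeries ℚ) := algebraRat.charZero _
  exact OfNat.ofNat_ne_zero n

theorem hasSubst_X_pow_three : PowerSeries.HasSubst (PowerSeries.X ^ 3 : ℚ⟦X⟧) :=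
  PowerSeries.HasSubst.X_pow three_ne_zero

/-- Substitution of `t ^ 3` for the variable. -/
noncomputable def cube : ℚ⟦X⟧ →ₐ[ℚ] ℚ⟦X⟧ := PowerSeries.substAlgHom hasSubst_X_pow_three

theorem cube_X : cube PowerSeries.X = PowerSeries.X ^ 3 :=
  PowerSeries.substAlgHom_X hasSubst_X_pow_three

theorem coeff_cube (f : ℚ⟦X⟧) (n : ℕ) : PowerSeries.coeff n (cube f) =
    if 3 ∣ n then PowerSeries.coeff (n / 3) f else 0 := by
  rw [cube, PowerSeries.coe_substAlgHom]
  exact PowerSeries.coeff_subst_X_pow three_ne_zero f n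

theorem constantCoeff_cube (f : ℚ⟦X⟧) :
    PowerSeries.constantCoeff (cube f) = PowerSeries.constantCoeff f := by
  rw [← PowerSeries.coeff_zero_eq_constantCoeff_apply, coeff_cube]
  simp

theorem cube_injective : Function.Injective cube := fun f g h => by
  ext n
  have := congrArg (PowerSeries.coeff (3 * n)) h
  simpa [coeff_cube] using this

theorem serV_eq_cube : serV = 2 * PowerSeries.X * cube serP := by
  symm
  refine existsUnique_V.choose_spec.2 _ ?_
  have h := congrArg cube serP_eq
  simp only [map_mul, map_ofNat, map_pow, map_sub, map_one, cube_X] at h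
  linear_combination (-2 * PowerSeries.X) * h

theorem serW_eq_cube : serW = cube serWs := by
  symm
  refine existsUnique_W.choose_spec.2 _ ⟨?_, ?_⟩
  · have h := congrArg cube serP_eq
    have h' := congrArg cube serP_eq_serWs
    simp only [map_mul, map_ofNat, map_pow, map_sub, map_add, map_one, cube_X] at h h'
    rw [serV_eq_cube]
    linear_combination (-2 : ℚ⟦X⟧) * h - (2 : ℚ⟦X⟧) * h'
  · rw [constantCoeff_cube, constantCoeff_serWs]

theorem serZ_eq_cube : serZ = cube serZs := by
  symm
  refine existsUnique_Z.choose_spec.2 _ ?_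
  have h := congrArg cube serZs_eq
  simpa only [map_mul, map_ofNat, map_pow, map_add, map_one, serW_eq_cube] using h

/-- The embedding of `ℚ⟦s⟧` in `ℚ((t))` with `s = t ^ 3`. -/
noncomputable def theta : ℚ⟦X⟧ →+* LaurentSeries ℚ :=
  (HahnSeries.ofPowerSeries ℤ ℚ).comp cube.toRingHom

theorem theta_injective : Function.Injective theta :=
  HahnSeries.ofPowerSeries_injective.comp cube_injective

theorem theta_apply (f : ℚ⟦X⟧) : theta f = ((cube f : ℚ⟦X⟧) : LaurentSeries ℚ) := rfl

theorem theta_X : theta PowerSeries.X = t ^ 3 := by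
  rw [theta_apply, cube_X, map_pow, t]

theorem theta_serWs : theta serWs = W := by rw [theta_apply, ← serW_eq_cube, W]

theorem theta_serZs : theta serZs = Z := by rw [theta_apply, ← serZ_eq_cube, Z]

theorem theta_serP : theta serP = 1 + 2 * W - 2 * W ^ 2 := by
  rw [serP_eq_serWs]
  simp only [map_mul, map_ofNat, map_pow, map_sub, map_add, map_one, theta_serWs]

theorem t_ne_zero : t ≠ 0 := fun h => by
  rw [t, map_eq_zero_iff _ HahnSeries.ofPowerSeries_injective] at h
  exact PowerSeries.X_ne_zero h

theorem theta_ne_zero_of_constantCoeff {f : ℚ⟦X⟧} (h : PowerSeries.constantCoeff f ≠ 0) :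
    theta f ≠ 0 := fun h0 => by
  rw [map_eq_zero_iff _ theta_injective] at h0
  simp [h0] at h

theorem theta_serP_ne_zero : theta serP ≠ 0 :=
  theta_ne_zero_of_constantCoeff (by simp [constantCoeff_serP])

theorem t_pow_three : 4 * t ^ 3 * theta serP ^ 3 = theta serP - 1 := by
  have h := congrArg theta serP_eq
  simpa only [map_mul, map_ofNat, map_pow, map_sub, map_one, theta_X] using h

theorem one_add_Z_sq_ne_zero : 1 + Z ^ 2 ≠ 0 := by
  have := theta_ne_zero_of_constantCoeff (f := 1 + serZs ^ 2) (by simp [constantCoeff_serZs])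
  simpa only [map_add, map_pow, map_one, theta_serZs] using this

theorem W_eq : W = 2 * Z / (1 + Z ^ 2) := by
  have h := congrArg theta serZs_eq
  simp only [map_mul, map_ofNat, map_pow, map_add, map_one, theta_serZs, theta_serWs] at h
  rw [eq_div_iff one_add_Z_sq_ne_zero, h]

theorem theta_serr : theta serr = (1 + W) * (1 - Z ^ 2) / ((1 + Z ^ 2) * theta serP) := by
  have h1 := congrArg theta serP_mul_inv
  have h2 := congrArg theta one_add_serZs_sq_mul_inv
  simp only [map_mul, map_pow, map_add, map_one, theta_serZs] at h1 h2
  rw [serr, eq_div_iff (mul_ne_zero one_add_Z_sq_ne_zero theta_serP_ne_zero)]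
  simp only [map_mul, map_pow, map_sub, map_add, map_one, theta_serZs, theta_serWs]
  linear_combination ((1 + W) * (1 - Z ^ 2) * theta serP * theta serP⁻¹) * h2 +
    ((1 + W) * (1 - Z ^ 2)) * h1

/-- The generating function of folded walks ending at `(a, b)`. -/
noncomputable def foldSer (a b : ℕ) : ℚ⟦X⟧ := PowerSeries.mk fun k => foldCount a b k

/-- By `exists_of_count_ne_zero`, only the lengths `a + b + 3 k` contribute. -/
theorem C_eq_theta (a b : ℕ) : C b (b - a) = t ^ (a + b) * theta (foldSer a b) := by
  rw [C, t, theta_apply, ← map_pow, ← map_mul]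
  congr 1
  ext n
  rw [PowerSeries.coeff_mk, PowerSeries.coeff_X_pow_mul', coeff_cube]
  split_ifs with h1 h2
  · obtain ⟨k, hk⟩ := h2
    rw [hk, Nat.mul_div_cancel_left _ (by norm_num), foldSer, PowerSeries.coeff_mk, foldCount]
    congr 2
    omega
  · rw [Nat.cast_eq_zero]
    by_contra h
    obtain ⟨k, hk⟩ := exists_of_count_ne_zero h
    exact h2 ⟨k, by omega⟩
  · rw [Nat.cast_eq_zero]
    exact count_eq_zero_of_lt (by omega)

theorem C_symm (i j : ℤ) : C i j = C j i := by
  simp only [C, count_symm i j]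

theorem two_mul_X_mul_foldSer_one_one :
    2 * (PowerSeries.X * foldSer 1 1) = foldSer 0 0 - 1 := by
  ext k
  have h := foldCount_zero 0 k
  rw [show (2 : ℚ⟦X⟧) = PowerSeries.C (2 : ℚ) from (map_ofNat PowerSeries.C 2).symm,
    PowerSeries.coeff_C_mul, map_sub, PowerSeries.coeff_one, foldSer, foldSer]
  cases k with
  | zero => simp [foldCount_zero_zero_zero]
  | succ k =>
    simp at h
    simp [PowerSeries.coeff_succ_X_mul, h]

theorem two_mul_X_mul_foldSer_one (b : ℕ) :
    2 * (PowerSeries.X * foldSer 1 (b + 2)) = foldSer 0 (b + 1) - foldSer 0 b := by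
  ext k
  have h := foldCount_zero (b + 1) k
  rw [show (2 : ℚ⟦X⟧) = PowerSeries.C (2 : ℚ) from (map_ofNat PowerSeries.C 2).symm,
    PowerSeries.coeff_C_mul, map_sub, foldSer, foldSer, foldSer]
  cases k with
  | zero =>
    simp at h
    simp [h]
  | succ k =>
    simp at h
    simp [PowerSeries.coeff_succ_X_mul, h]

theorem X_mul_foldSer_one (a : ℕ) :
    PowerSeries.X * foldSer (a + 2) 1 = foldSer (a + 1) 0 - foldSer a 0 := by
  ext k
  have h := foldCount_succ a 0 k
  rw [map_sub, foldSer, foldSer, foldSer]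
  cases k with
  | zero =>
    simp at h
    simp [h]
  | succ k =>
    simp at h
    simp [PowerSeries.coeff_succ_X_mul, h]

theorem X_mul_foldSer (a b : ℕ) : PowerSeries.X * foldSer (a + 2) (b + 2) =
    foldSer (a + 1) (b + 1) - foldSer (a + 1) b - foldSer a (b + 1) := by
  ext k
  have h := foldCount_succ a (b + 1) k
  rw [map_sub, map_sub, foldSer, foldSer, foldSer, foldSer]
  cases k with
  | zero =>
    simp at h
    simp [h]
  | succ k =>
    simp at h
    simp [PowerSeries.coeff_succ_X_mul, h]
    ring

end Theta

/-! ### Power series with coefficients in a subfield -/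

section Coefficients

variable {E : Type*} [Field E] [Algebra ℚ E] (K : IntermediateField ℚ E)

/-- The power series with coefficients in a subfield. -/
noncomputable def seriesOver : Subring E⟦X⟧ := (PowerSeries.map (algebraMap K E)).range

variable {K}

theorem mem_seriesOver {g : E⟦X⟧} : g ∈ seriesOver K ↔ ∀ n, PowerSeries.coeff n g ∈ K := by
  constructor
  · rintro ⟨f, rfl⟩ n
    rw [PowerSeries.coeff_map]
    exact (PowerSeries.coeff n f).2
  · intro h
    refine ⟨PowerSeries.mk fun n => ⟨_, h n⟩, ?_⟩
    ext n
    rw [PowerSeries.coeff_map, PowerSeries.coeff_mk]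
    rfl

theorem C_mem_seriesOver {e : E} (h : e ∈ K) : PowerSeries.C e ∈ seriesOver K :=
  ⟨PowerSeries.C ⟨e, h⟩, PowerSeries.map_C _ _⟩

theorem X_mem_seriesOver : PowerSeries.X ∈ seriesOver K := ⟨PowerSeries.X, PowerSeries.map_X _⟩

theorem mem_seriesOver_of_X_mul {g : E⟦X⟧} (h : PowerSeries.X * g ∈ seriesOver K) :
    g ∈ seriesOver K := mem_seriesOver.2 fun n => by
  have := mem_seriesOver.1 h (n + 1)
  rwa [PowerSeries.coeff_succ_X_mul] at this

theorem mem_seriesOver_of_mul {g h : E⟦X⟧} (hh : h ∈ seriesOver K)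
    (h0 : PowerSeries.constantCoeff h ≠ 0) (hgh : g * h ∈ seriesOver K) : g ∈ seriesOver K := by
  obtain ⟨h', rfl⟩ := hh
  have h0' : PowerSeries.constantCoeff h' ≠ 0 := fun h1 => h0 (by
    rw [← PowerSeries.coeff_zero_eq_constantCoeff_apply, PowerSeries.coeff_map,
      PowerSeries.coeff_zero_eq_constantCoeff_apply, h1, map_zero])
  have h1 := congrArg (PowerSeries.map (algebraMap K E)) (PowerSeries.mul_inv_cancel h' h0')
  rw [map_mul, map_one] at h1
  have : g = g * PowerSeries.map (algebraMap K E) h' *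
      PowerSeries.map (algebraMap K E) h'⁻¹ := by rw [mul_assoc, h1, mul_one]
  rw [this]
  exact (seriesOver K).mul_mem hgh ⟨_, rfl⟩

/-- A square root with the same constant term exists over `K` itself, and in a domain it can only
differ from `g` by a sign, which the nonzero constant term fixes. -/
theorem mem_seriesOver_of_sq {g : E⟦X⟧} (hg : g ^ 2 ∈ seriesOver K)
    (h0 : PowerSeries.constantCoeff g ∈ K) (hne : PowerSeries.constantCoeff g ≠ 0) :
    g ∈ seriesOver K := by
  obtain ⟨f, hf⟩ := hg
  have : CharZero E := algebraRat.charZero E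
  have h4 : (4 : K) * (1 / 4) = 1 := by norm_num
  have hcoe : ∀ h : K⟦X⟧, PowerSeries.constantCoeff (PowerSeries.map (algebraMap K E) h) =
      ((PowerSeries.constantCoeff h : K) : E) := fun h => by
    rw [← PowerSeries.coeff_zero_eq_constantCoeff_apply, PowerSeries.coeff_map,
      PowerSeries.coeff_zero_eq_constantCoeff_apply]
    rfl
  have hr : (⟨_, h0⟩ : K) ≠ 0 := fun h => hne (congrArg Subtype.val h)
  obtain ⟨h, hh, hh0⟩ := exists_sq_eq h4 (mul_inv_cancel₀ hr) (f := f) (by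
    refine Subtype.ext ?_
    rw [← hcoe, hf, map_pow]
    rfl)
  have h1 : PowerSeries.map (algebraMap K E) h ^ 2 = g ^ 2 := by rw [← map_pow, hh, hf]
  rcases sq_eq_sq_iff_eq_or_eq_neg.1 h1 with h2 | h2
  · exact ⟨h, h2⟩
  · have h3 := congrArg PowerSeries.constantCoeff h2
    rw [hcoe, hh0, map_neg] at h3
    exact absurd (self_eq_neg.1 h3) hne

end Coefficients

/-! ### Which fields contain the generating functions -/

section Membership

variable {K : IntermediateField ℚ (LaurentSeries ℚ)}

theorem theta_serP_mem (hW : W ∈ K) : theta serP ∈ K := by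
  rw [theta_serP]
  exact sub_mem (add_mem K.one_mem (mul_mem (ofNat_mem K 2) hW))
    (mul_mem (ofNat_mem K 2) (pow_mem hW 2))

theorem t_pow_three_eq : t ^ 3 = (theta serP - 1) / (4 * theta serP ^ 3) := by
  rw [eq_div_iff (mul_ne_zero (laurentSeries_ofNat_ne_zero 4) (pow_ne_zero 3
    theta_serP_ne_zero)), ← t_pow_three]
  ring

theorem t_pow_three_mem (hW : W ∈ K) : t ^ 3 ∈ K := by
  rw [t_pow_three_eq]
  exact div_mem (sub_mem (theta_serP_mem hW) K.one_mem)
    (mul_mem (ofNat_mem K 4) (pow_mem (theta_serP_mem hW) 3))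

theorem theta_inv_mem {f : ℚ⟦X⟧} (hf : f * f⁻¹ = 1) (h : theta f ∈ K) : theta f⁻¹ ∈ K := by
  have h1 := congrArg theta hf
  rw [map_mul, map_one] at h1
  rw [eq_inv_of_mul_eq_one_right h1]
  exact inv_mem h

theorem theta_serr_sq_mem (hW : W ∈ K) : theta serr ^ 2 ∈ K := by
  have h := congrArg theta serr_sq
  simp only [map_mul, map_pow, map_sub, map_add, map_one, theta_serWs] at h
  rw [eq_div_of_mul_eq (pow_ne_zero 2 theta_serP_ne_zero) ((mul_comm _ _).trans h)]
  exact div_mem (mul_mem (sub_mem K.one_mem hW) (pow_mem (add_mem K.one_mem hW) 3))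
    (pow_mem (theta_serP_mem hW) 2)

theorem constantCoeff_map_theta (f : ℚ⟦X⟧⟦X⟧) :
    PowerSeries.constantCoeff (PowerSeries.map theta f) = theta (PowerSeries.constantCoeff f) := by
  rw [← PowerSeries.coeff_zero_eq_constantCoeff_apply, PowerSeries.coeff_map,
    PowerSeries.coeff_zero_eq_constantCoeff_apply]

theorem map_theta_C (f : ℚ⟦X⟧) :
    PowerSeries.map theta (PowerSeries.C f) = PowerSeries.C (theta f) := PowerSeries.map_C _ _

theorem serS_mem (hW : W ∈ K) : PowerSeries.map theta serS ∈ seriesOver K := by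
  have hP := theta_serP_mem hW
  refine mem_seriesOver_of_sq ?_ ?_ ?_
  · rw [← map_pow, serS_sq]
    simp only [map_add, map_sub, map_mul, map_pow, map_one, map_theta_C, PowerSeries.map_X]
    have hX : PowerSeries.X ∈ seriesOver K := X_mem_seriesOver
    have hPC := C_mem_seriesOver hP
    exact add_mem (sub_mem (one_mem _) (mul_mem (mul_mem hPC (add_mem hPC (one_mem _))) hX))
      (mul_mem (pow_mem hPC 2) (pow_mem hX 2))
  · rw [constantCoeff_map_theta, constantCoeff_serS, map_one]
    exact K.one_mem
  · rw [constantCoeff_map_theta, constantCoeff_serS, map_one]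
    exact one_ne_zero

theorem serB_sq_mem (hW : W ∈ K) : PowerSeries.map theta serB ^ 2 ∈ seriesOver K := by
  have hP := theta_serP_mem hW
  have h2 : ∀ n : ℕ, [n.AtLeastTwo] → (OfNat.ofNat n : (LaurentSeries ℚ)⟦X⟧) ∈ seriesOver K :=
    fun n _ => ofNat_mem _ n
  have hX : PowerSeries.X ∈ seriesOver K := X_mem_seriesOver
  have hPC := C_mem_seriesOver hP
  have hPi := C_mem_seriesOver (theta_inv_mem serP_mul_inv hP)
  have hWC := C_mem_seriesOver hW
  have ht := C_mem_seriesOver (t_pow_three_mem hW)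
  have hS := serS_mem hW
  refine mem_seriesOver_of_X_mul ?_
  have h := congrArg (PowerSeries.map theta) serB_sq
  simp only [serI, serc, map_add, map_sub, map_mul, map_pow, map_one, map_theta_C, map_ofNat,
    PowerSeries.map_X, theta_X, theta_serWs] at h
  rw [h]
  rw [map_pow] at ht
  exact add_mem (sub_mem (mul_mem (mul_mem (mul_mem (sub_mem (one_mem _) hWC)
    (add_mem (add_mem (one_mem _) (mul_mem (h2 2) hWC)) (mul_mem (h2 4) (pow_mem hWC 2))))
      (pow_mem hPi 2)) hX) (mul_mem (h2 2) (add_mem (sub_mem (pow_mem hX 2) (pow_mem hX 3)) ht)))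
    (mul_mem (mul_mem (h2 2) (sub_mem (mul_mem ht (add_mem (one_mem _) (mul_mem (mul_mem (h2 2)
      hPC) hX))) (mul_mem hPi (pow_mem hX 2)))) hS)

theorem theta_serr_ne_zero : theta serr ≠ 0 :=
  theta_ne_zero_of_constantCoeff (by simp [constantCoeff_serr])

/-- Neither `r` nor `B` need be defined over `K`, but `A ^ 2` involves only `r ^ 2`, `B ^ 2` and `S
^ 2`. Since `A(0) = 1` lies in `K`, the root `A` is defined over `K` too. -/
theorem serA_mem (hW : W ∈ K) : PowerSeries.map theta serA ∈ seriesOver K := by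
  have hP := theta_serP_mem hW
  refine mem_seriesOver_of_sq ?_ ?_ ?_
  · refine mem_seriesOver_of_mul (mul_mem (serB_sq_mem hW) (pow_mem (serS_mem hW) 2)) ?_ ?_
    · rw [map_mul, map_pow, map_pow, constantCoeff_map_theta, constantCoeff_map_theta,
        constantCoeff_serB, constantCoeff_serS, map_one, one_pow, mul_one]
      exact pow_ne_zero 2 theta_serr_ne_zero
    · have h := congrArg (fun f => PowerSeries.map theta f ^ 2) serA_mul
      simp only [map_sub, map_mul, map_one, map_theta_C, map_ofNat, PowerSeries.map_X] at h
      rw [mul_pow, mul_pow, mul_pow] at h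
      rw [h, ← map_pow]
      have hX : PowerSeries.X ∈ seriesOver K := X_mem_seriesOver
      exact mul_mem (C_mem_seriesOver (theta_serr_sq_mem hW)) (pow_mem (sub_mem (one_mem _)
        (mul_mem (mul_mem (ofNat_mem _ 2) (C_mem_seriesOver hP)) hX)) 2)
  · rw [constantCoeff_map_theta, constantCoeff_serA, map_one]
    exact K.one_mem
  · rw [constantCoeff_map_theta, constantCoeff_serA, map_one]
    exact one_ne_zero

theorem foldSer_zero_mem (hW : W ∈ K) (b : ℕ) : theta (foldSer 0 b) ∈ K := by
  have h1 := serD_serR_eq.1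
  have h2 := mem_seriesOver.1 (serA_mem hW) (b + 1)
  have h3 : PowerSeries.coeff (b + 1) serA = foldSer 0 b := by
    rw [h1, map_add, PowerSeries.coeff_succ_X_mul, PowerSeries.coeff_one, if_neg (by omega),
      zero_add, serD, PowerSeries.coeff_mk, foldSer]
  rwa [PowerSeries.coeff_map, h3] at h2

theorem mem_of_two_mul_X_mul (hW : W ∈ K) {f : ℚ⟦X⟧}
    (h : theta (2 * (PowerSeries.X * f)) ∈ K) : theta f ∈ K := by
  rw [map_mul, map_mul, map_ofNat, theta_X] at h
  have h1 : theta f = 2 * (t ^ 3 * theta f) / (2 * t ^ 3) := by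
    rw [eq_div_iff (mul_ne_zero (laurentSeries_ofNat_ne_zero 2) (pow_ne_zero 3 t_ne_zero))]
    ring
  rw [h1]
  exact div_mem h (mul_mem (ofNat_mem K 2) (t_pow_three_mem hW))

theorem mem_of_X_mul (hW : W ∈ K) {f : ℚ⟦X⟧} (h : theta (PowerSeries.X * f) ∈ K) :
    theta f ∈ K :=
  mem_of_two_mul_X_mul hW (by
    rw [map_mul, map_ofNat]
    exact mul_mem (ofNat_mem K 2) h)

theorem foldSer_one_mem (hW : W ∈ K) (b : ℕ) : theta (foldSer 1 (b + 1)) ∈ K := by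
  refine mem_of_two_mul_X_mul hW ?_
  cases b with
  | zero =>
    rw [zero_add, two_mul_X_mul_foldSer_one_one, map_sub, map_one]
    exact sub_mem (foldSer_zero_mem hW 0) K.one_mem
  | succ b =>
    rw [two_mul_X_mul_foldSer_one, map_sub]
    exact sub_mem (foldSer_zero_mem hW _) (foldSer_zero_mem hW b)

theorem foldSer_succ_zero (a : ℕ) :
    foldSer (a + 1) 0 = PowerSeries.coeff (a + 1) serR := by
  rw [serR, PowerSeries.coeff_mk, foldSer]
  simp

theorem two_mul_X_mul_foldSer_succ_zero (a : ℕ) : 2 * (PowerSeries.X * foldSer (a + 1) 0) =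
    PowerSeries.coeff a (1 - 2 * PowerSeries.X - serB) := by
  have h := congrArg (PowerSeries.coeff (a + 1)) serD_serR_eq.2
  rw [PowerSeries.coeff_succ_X_mul, show (2 : ℚ⟦X⟧⟦X⟧) = PowerSeries.C 2 from
    (map_ofNat PowerSeries.C 2).symm, mul_assoc, PowerSeries.coeff_C_mul, PowerSeries.coeff_C_mul,
    ← foldSer_succ_zero, map_ofNat] at h
  exact h

/-- Here `B` itself is needed and not only its square, whence the hypothesis on its constant term
`r`. -/
theorem foldSer_succ_zero_mem (hW : W ∈ K) (hr : theta serr ∈ K) (a : ℕ) :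
    theta (foldSer (a + 1) 0) ∈ K := by
  refine mem_of_two_mul_X_mul hW ?_
  rw [two_mul_X_mul_foldSer_succ_zero, ← PowerSeries.coeff_map]
  refine mem_seriesOver.1 ?_ a
  simp only [map_sub, map_mul, map_one, map_ofNat, PowerSeries.map_X]
  refine sub_mem (sub_mem (one_mem _) (mul_mem (ofNat_mem _ 2) X_mem_seriesOver)) ?_
  refine mem_seriesOver_of_sq (serB_sq_mem hW) ?_ ?_
  · rwa [constantCoeff_map_theta, constantCoeff_serB]
  · rw [constantCoeff_map_theta, constantCoeff_serB]
    exact theta_serr_ne_zero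

theorem foldSer_mem (hW : W ∈ K) (hr : theta serr ∈ K) (a b : ℕ) : theta (foldSer a b) ∈ K := by
  -- The recurrences are solved for the starting point of the west step, which expresses the series
  -- at `b` through series with smaller `b`. The case `a = 1`, `b > 0` comes from the diagonal and
  -- `b = 0` from `R`.
  induction b using Nat.strong_induction_on generalizing a with
  | _ b ih =>
    rcases a with _ | _ | a
    · exact foldSer_zero_mem hW b
    · cases b with
      | zero => exact foldSer_succ_zero_mem hW hr 0
      | succ b => exact foldSer_one_mem hW b
    · rcases b with _ | _ | b
      · exact foldSer_succ_zero_mem hW hr (a + 1)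
      · refine mem_of_X_mul hW ?_
        rw [zero_add, X_mul_foldSer_one, map_sub]
        exact sub_mem (ih 0 (by omega) _) (ih 0 (by omega) _)
      · refine mem_of_X_mul hW ?_
        rw [X_mul_foldSer, map_sub, map_sub]
        exact sub_mem (sub_mem (ih (b + 1) (by omega) _) (ih b (by omega) _))
          (ih (b + 1) (by omega) _)

/-- In the region below the diagonal, `t ^ (i + j) C_{i,j}` is a series in `s = t ^ 3`. -/
theorem t_zpow_mul_C (a b : ℕ) :
    t ^ ((b : ℤ) + ((b : ℤ) - a)) * C b (b - a) = (t ^ 3) ^ b * theta (foldSer a b) := by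
  rw [C_eq_theta, ← mul_assoc, ← zpow_natCast t (a + b), ← zpow_add₀ t_ne_zero, ← pow_mul,
    ← zpow_natCast t (3 * b)]
  congr 2
  push_cast
  ring

end Membership

end Kreweras

namespace Kreweras

/-! ### Degrees of the field extensions -/

section Degrees

variable {F : Type*} [Field F]

theorem natDegree_num_div {p q : Polynomial F} (hpq : IsCoprime p q) (hq : q ≠ 0) :
    (RatFunc.num (algebraMap _ (RatFunc F) p / algebraMap _ (RatFunc F) q)).natDegree =
        p.natDegree ∧
      (RatFunc.denom (algebraMap _ (RatFunc F) p / algebraMap _ (RatFunc F) q)).natDegree =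
        q.natDegree := by
  set f := algebraMap _ (RatFunc F) p / algebraMap _ (RatFunc F) q with hf
  have hq' : algebraMap (Polynomial F) (RatFunc F) q ≠ 0 := by
    simpa using hq
  have hd' : algebraMap (Polynomial F) (RatFunc F) f.denom ≠ 0 := by
    simpa using f.denom_ne_zero
  have h : f.num * q = p * f.denom := by
    have h1 := f.num_div_denom
    rw [hf, div_eq_div_iff hd' hq', ← map_mul, ← map_mul] at h1
    exact RatFunc.algebraMap_injective F h1
  have h1 : f.num ∣ p := RatFunc.num_div_dvd p hq
  have h2 : f.denom ∣ q := RatFunc.denom_div_dvd p q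
  have h3 : p ∣ f.num := hpq.dvd_of_dvd_mul_right ⟨_, h⟩
  have h4 : q ∣ f.denom := hpq.symm.dvd_of_dvd_mul_left ⟨f.num, by rw [← h, mul_comm]⟩
  exact ⟨Polynomial.natDegree_eq_of_degree_eq
      (Polynomial.degree_eq_degree_of_associated (associated_of_dvd_dvd h1 h3)),
    Polynomial.natDegree_eq_of_degree_eq
      (Polynomial.degree_eq_degree_of_associated (associated_of_dvd_dvd h2 h4))⟩

/-- The degree of `F(g)` over the field generated by a rational function of `g`. -/
theorem relfinrank_adjoin_div {E : Type*} [Field E] [Algebra F E] {g : E}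
    (hg : Transcendental F g) {p q : Polynomial F} (hpq : IsCoprime p q) (hq : q ≠ 0) :
    (IntermediateField.adjoin F {Polynomial.aeval g p / Polynomial.aeval g q}).relfinrank
      (IntermediateField.adjoin F {g}) = max p.natDegree q.natDegree := by
  set ι : RatFunc F →ₐ[F] E := (IntermediateField.val _).comp
    (RatFunc.algEquivOfTranscendental g hg).toAlgHom with hι
  have hp : ∀ r : Polynomial F, ι (algebraMap _ _ r) = Polynomial.aeval g r := fun r => by
    rw [hι, AlgHom.comp_apply]
    change ((RatFunc.algEquivOfTranscendental g hg (algebraMap _ _ r) : _) : E) = _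
    rw [RatFunc.algEquivOfTranscendental_algebraMap]
    exact (Polynomial.aeval_algHom_apply (IntermediateField.val _) _ r).symm
  have h1 : IntermediateField.adjoin F {Polynomial.aeval g p / Polynomial.aeval g q} =
      (IntermediateField.adjoin F
        {algebraMap _ (RatFunc F) p / algebraMap _ (RatFunc F) q}).map ι := by
    rw [IntermediateField.adjoin_map, Set.image_singleton, map_div₀, hp, hp]
  have h2 : IntermediateField.adjoin F {g} =
      (IntermediateField.adjoin F {(RatFunc.X : RatFunc F)}).map ι := by
    rw [IntermediateField.adjoin_map, Set.image_singleton, ← RatFunc.algebraMap_X, hp,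
      Polynomial.aeval_X]
  rw [h1, h2, IntermediateField.relfinrank_map_map, RatFunc.adjoin_X,
    IntermediateField.relfinrank_top_right, RatFunc.finrank_eq_max_natDegree,
    (natDegree_num_div hpq hq).1, (natDegree_num_div hpq hq).2]

theorem isExtensionOfDegree_of_relfinrank {K L : IntermediateField ℚ (LaurentSeries ℚ)} {d : ℕ}
    (h : K ≤ L) (hd : K.relfinrank L = d) (h0 : d ≠ 0) : IsExtensionOfDegree K L d := by
  rw [IntermediateField.relfinrank_eq_finrank_of_le h] at hd
  -- An infinite extension would have `finrank` zero by convention, so `d ≠ 0` gives finiteness.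
  exact ⟨h, Module.finite_of_finrank_pos (by omega), hd⟩

theorem extendScalars_sup_adjoin (K : IntermediateField ℚ (LaurentSeries ℚ))
    (x : LaurentSeries ℚ) :
    IntermediateField.extendScalars (le_sup_left : K ≤ K ⊔ IntermediateField.adjoin ℚ {x}) =
      IntermediateField.adjoin K {x} := by
  refine le_antisymm ?_ ?_
  · rw [IntermediateField.extendScalars_le_iff]
    refine sup_le ?_ ?_
    · intro y hy
      exact (IntermediateField.adjoin K {x}).algebraMap_mem ⟨y, hy⟩
    · rw [IntermediateField.adjoin_simple_le_iff]
      exact IntermediateField.mem_adjoin_simple_self K x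
  · rw [IntermediateField.adjoin_simple_le_iff]
    exact (le_sup_right : _ ≤ K ⊔ IntermediateField.adjoin ℚ {x})
      (IntermediateField.mem_adjoin_simple_self ℚ x)

theorem isAlgebraic_and_natDegree_minpoly_le {E : Type*} [Field E] [Algebra F E]
    (L : IntermediateField F E) [FiniteDimensional F L] {f : E} (hf : f ∈ L) :
    IsAlgebraic F f ∧ (minpoly F f).natDegree ≤ Module.finrank F L := by
  have hx : minpoly F (⟨f, hf⟩ : L) = minpoly F f := IntermediateField.minpoly_eq (⟨f, hf⟩ : L)
  have hint : IsIntegral F f := IsIntegral.algebraMap (B := E)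
    (Algebra.IsIntegral.isIntegral (R := F) (⟨f, hf⟩ : L))
  exact ⟨hint.isAlgebraic, hx ▸ minpoly.natDegree_le _⟩

theorem hasDegreeAtMost_of_mem {K L : IntermediateField ℚ (LaurentSeries ℚ)} {d : ℕ}
    {f : LaurentSeries ℚ} (h : IsExtensionOfDegree K L d) (hf : f ∈ L) :
    HasDegreeAtMost K f d := by
  obtain ⟨hKL, hfin, hd⟩ := h
  have := isAlgebraic_and_natDegree_minpoly_le (IntermediateField.extendScalars hKL) (f := f) hf
  rwa [hd] at this

theorem hasDegree_of_isExtensionOfDegree {K : IntermediateField ℚ (LaurentSeries ℚ)} {d : ℕ}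
    {f : LaurentSeries ℚ}
    (h : IsExtensionOfDegree K (K ⊔ IntermediateField.adjoin ℚ {f}) d) : HasDegree K f d := by
  have h1 := (hasDegreeAtMost_of_mem h (le_sup_right (a := K)
    (IntermediateField.mem_adjoin_simple_self ℚ f))).1
  refine ⟨h1, ?_⟩
  obtain ⟨hKL, -, hd⟩ := h
  rw [← IntermediateField.adjoin.finrank h1.isIntegral, ← hd, ← extendScalars_sup_adjoin]

theorem transcendental_t : Transcendental ℚ t := by
  rw [transcendental_iff_injective]
  have h : ∀ p : Polynomial ℚ, Polynomial.aeval t p =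
      ((p : ℚ⟦X⟧) : LaurentSeries ℚ) := fun p => by
    have h1 : Polynomial.aeval (PowerSeries.X : ℚ⟦X⟧) p = p := by
      induction p using Polynomial.induction_on' with
      | add p q hp hq => simp [hp, hq]
      | monomial n a =>
        rw [Polynomial.aeval_monomial, Polynomial.coe_monomial]
        ext m
        simp [PowerSeries.coeff_X_pow, PowerSeries.coeff_monomial]
    conv_rhs => rw [← h1]
    exact Polynomial.aeval_algHom_apply (HahnSeries.ofPowerSeries ℤ ℚ).toRatAlgHom
      (PowerSeries.X : ℚ⟦X⟧) p
  intro p q hpq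
  rw [h, h] at hpq
  exact Polynomial.coe_injective ℚ (HahnSeries.ofPowerSeries_injective hpq)

theorem transcendental_of_adjoin {x y : LaurentSeries ℚ} (hx : Transcendental ℚ x)
    (h : x ∈ field {y}) : Transcendental ℚ y := fun hy => hx (by
  have : field {y} ≤ algebraicClosure ℚ (LaurentSeries ℚ) :=
    IntermediateField.adjoin_simple_le_iff.2 (mem_algebraicClosure_iff.2 hy)
  exact mem_algebraicClosure_iff.1 (this h))

theorem V_pow_three : V ^ 3 = 4 * W * (1 - W) := by
  have h := congrArg (HahnSeries.ofPowerSeries ℤ ℚ) serW_eq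
  simp only [map_mul, map_sub, map_one, map_pow, map_ofNat] at h
  exact h.symm

theorem V_eq_t_mul : V = t * (2 + V ^ 3) := by
  have h := congrArg (HahnSeries.ofPowerSeries ℤ ℚ) serV_eq
  simp only [map_mul, map_add, map_pow, map_ofNat] at h
  exact h

theorem two_add_V_pow_three_ne_zero : 2 + V ^ 3 ≠ 0 := by
  rw [V_pow_three]
  have h := mul_ne_zero (laurentSeries_ofNat_ne_zero 2) theta_serP_ne_zero
  rw [theta_serP] at h
  intro h'
  apply h
  linear_combination h'

theorem t_pow_three_eq_V : t ^ 3 = V ^ 3 / (2 + V ^ 3) ^ 3 := by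
  rw [eq_div_iff (pow_ne_zero 3 two_add_V_pow_three_ne_zero), ← mul_pow, ← V_eq_t_mul]

theorem t_pow_three_mem_field : t ^ 3 ∈ field {V ^ 3} := by
  have h := IntermediateField.mem_adjoin_simple_self ℚ (V ^ 3)
  rw [t_pow_three_eq_V]
  exact div_mem h (pow_mem (add_mem (ofNat_mem _ 2) h) 3)

theorem V_pow_three_mem_field : V ^ 3 ∈ field {W} := by
  have h := IntermediateField.mem_adjoin_simple_self ℚ W
  rw [V_pow_three]
  exact mul_mem (mul_mem (ofNat_mem _ 4) h) (sub_mem (one_mem _) h)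

theorem W_mem_field : W ∈ field {Z} := by
  have h := IntermediateField.mem_adjoin_simple_self ℚ Z
  rw [W_eq]
  exact div_mem (mul_mem (ofNat_mem _ 2) h) (add_mem (one_mem _) (pow_mem h 2))

theorem field_t_le : field {t ^ 3} ≤ field {t} :=
  IntermediateField.adjoin_simple_le_iff.2
    (pow_mem (IntermediateField.mem_adjoin_simple_self ℚ t) 3)

theorem field_V_le : field {t ^ 3} ≤ field {V ^ 3} :=
  IntermediateField.adjoin_simple_le_iff.2 t_pow_three_mem_field

theorem field_W_le : field {V ^ 3} ≤ field {W} :=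
  IntermediateField.adjoin_simple_le_iff.2 V_pow_three_mem_field

theorem field_Z_le : field {W} ≤ field {Z} :=
  IntermediateField.adjoin_simple_le_iff.2 W_mem_field

theorem transcendental_V_pow_three : Transcendental ℚ (V ^ 3) :=
  transcendental_of_adjoin (transcendental_t.pow (by norm_num)) t_pow_three_mem_field

theorem transcendental_W : Transcendental ℚ W :=
  transcendental_of_adjoin transcendental_V_pow_three V_pow_three_mem_field

theorem transcendental_Z : Transcendental ℚ Z :=
  transcendental_of_adjoin transcendental_W W_mem_field

theorem relfinrank_t : (field {t ^ 3}).relfinrank (field {t}) = 3 := by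
  have h := relfinrank_adjoin_div transcendental_t (p := Polynomial.X ^ 3) (q := 1)
    isCoprime_one_right one_ne_zero
  simpa using h

theorem relfinrank_V : (field {t ^ 3}).relfinrank (field {V ^ 3}) = 3 := by
  have h := relfinrank_adjoin_div transcendental_V_pow_three (p := Polynomial.X)
    (q := (2 + Polynomial.X) ^ 3)
    (IsCoprime.pow_right ⟨-Polynomial.C (1 / 2), Polynomial.C (1 / 2), by
      have : Polynomial.C (1 / 2 : ℚ) * 2 = 1 := by
        rw [show (2 : Polynomial ℚ) = Polynomial.C 2 from (map_ofNat Polynomial.C 2).symm,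
          ← Polynomial.C_mul]
        norm_num
      linear_combination this⟩)
    (pow_ne_zero 3 (by rw [add_comm]; exact Polynomial.X_add_C_ne_zero (2 : ℚ)))
  have hd : (2 + Polynomial.X : Polynomial ℚ).natDegree = 1 := by
    rw [add_comm]
    exact Polynomial.natDegree_X_add_C (2 : ℚ)
  rw [Polynomial.natDegree_pow, hd, Polynomial.natDegree_X] at h
  simp only [map_pow, map_add, Polynomial.aeval_X, map_ofNat] at h
  rw [← t_pow_three_eq_V] at h
  simpa using h

theorem relfinrank_W : (field {V ^ 3}).relfinrank (field {W}) = 2 := by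
  have h := relfinrank_adjoin_div transcendental_W
    (p := Polynomial.C 4 * Polynomial.X * (1 - Polynomial.X)) (q := 1)
    isCoprime_one_right one_ne_zero
  have hd : (Polynomial.C 4 * Polynomial.X * (1 - Polynomial.X) : Polynomial ℚ).natDegree = 2 := by
    have : (Polynomial.C 4 * Polynomial.X * (1 - Polynomial.X) : Polynomial ℚ) =
      Polynomial.C (-4) * Polynomial.X ^ 2 + Polynomial.C 4 * Polynomial.X + Polynomial.C 0 := by
      simp
      ring
    rw [this]
    exact Polynomial.natDegree_quadratic (by norm_num)
  rw [hd] at h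
  simp only [map_mul, map_sub, map_one, Polynomial.aeval_X, map_ofNat, div_one] at h
  rw [← V_pow_three] at h
  simpa using h

theorem relfinrank_Z : (field {W}).relfinrank (field {Z}) = 2 := by
  have h := relfinrank_adjoin_div transcendental_Z
    (p := Polynomial.C 2 * Polynomial.X) (q := 1 + Polynomial.X ^ 2)
    ⟨-Polynomial.C (1 / 2) * Polynomial.X, 1, by
      have : Polynomial.C (1 / 2 : ℚ) * Polynomial.C 2 = 1 := by
        rw [← Polynomial.C_mul]
        norm_num
      linear_combination -Polynomial.X ^ 2 * this⟩
    (by rw [add_comm]; exact Polynomial.X_pow_add_C_ne_zero (by norm_num) (1 : ℚ))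
  have hd : (1 + Polynomial.X ^ 2 : Polynomial ℚ).natDegree = 2 := by
    rw [add_comm]
    exact Polynomial.natDegree_X_pow_add_C (n := 2) (r := (1 : ℚ))
  rw [hd, Polynomial.natDegree_C_mul_X _ (by norm_num)] at h
  simp only [map_mul, map_add, map_one, map_pow, Polynomial.aeval_X, map_ofNat] at h
  rw [← W_eq] at h
  simpa using h

theorem aeval_theta (g : ℚ⟦X⟧) (p : Polynomial ℚ) :
    Polynomial.aeval (theta g) p = theta (Polynomial.aeval g p) :=
  Polynomial.aeval_algHom_apply theta.toRatAlgHom g p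

/-- The fields generated by a series in `t ^ 3` contain no cube root of `t ^ 3`. -/
theorem pow_three_ne (g : ℚ⟦X⟧) {x : LaurentSeries ℚ} (hx : x ∈ field {theta g}) :
    x ^ 3 ≠ t ^ 3 := by
  intro h
  obtain ⟨r, s, rfl⟩ := (IntermediateField.mem_adjoin_simple_iff ℚ x).1 hx
  rw [aeval_theta, aeval_theta] at h
  generalize Polynomial.aeval g r = u at h
  generalize Polynomial.aeval g s = v at h
  have hv : v ≠ 0 := by
    rintro rfl
    rw [map_zero, div_zero, zero_pow three_ne_zero] at h
    exact pow_ne_zero 3 t_ne_zero h.symm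
  have hv' : theta v ≠ 0 := fun h0 => hv ((map_eq_zero_iff _ theta_injective).1 h0)
  rw [div_pow, div_eq_iff (pow_ne_zero 3 hv'), ← theta_X, ← map_pow, ← map_pow, ← map_mul] at h
  -- The equation `u ^ 3 = s v ^ 3` would give `3 ord u = 1 + 3 ord v`.
  have h1 := congrArg PowerSeries.order (theta_injective h)
  have hu : u ≠ 0 := by
    rintro rfl
    have := theta_injective h
    rw [zero_pow three_ne_zero] at this
    exact mul_ne_zero PowerSeries.X_ne_zero (pow_ne_zero 3 hv) this.symm
  rw [PowerSeries.order_mul, PowerSeries.order_pow, PowerSeries.order_pow, PowerSeries.order_X,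
    ← PowerSeries.coe_toNat_order hu, ← PowerSeries.coe_toNat_order hv] at h1
  simp only [nsmul_eq_mul] at h1
  norm_cast at h1
  omega

theorem relfinrank_sup_t (g : ℚ⟦X⟧) (hg : t ^ 3 ∈ field {theta g}) :
    (field {theta g}).relfinrank (field {theta g} ⊔ field {t}) = 3 := by
  set K := field {theta g}
  rw [IntermediateField.relfinrank_eq_finrank_of_le le_sup_left, extendScalars_sup_adjoin]
  have hirr : Irreducible (Polynomial.X ^ 3 - Polynomial.C (⟨t ^ 3, hg⟩ : K)) :=
    X_pow_sub_C_irreducible_of_prime Nat.prime_three fun b hb =>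
      pow_three_ne g b.2 (congrArg Subtype.val hb)
  have hroot : Polynomial.aeval t (Polynomial.X ^ 3 - Polynomial.C (⟨t ^ 3, hg⟩ : K)) = 0 := by
    rw [map_sub, map_pow, Polynomial.aeval_X, Polynomial.aeval_C]
    exact sub_self _
  have hmonic := Polynomial.monic_X_pow_sub_C (⟨t ^ 3, hg⟩ : K) three_ne_zero
  rw [IntermediateField.adjoin.finrank ⟨_, hmonic, hroot⟩,
    ← minpoly.eq_of_irreducible_of_monic hirr hroot hmonic]
  exact Polynomial.natDegree_X_pow_sub_C

/-- The degree of `ℚ(t, g)` over `ℚ(t ^ 3)` is computed through `ℚ(g)` and through `ℚ(t)`. The steps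
that adjoin `t` both have degree 3, so the other two degrees agree. -/
theorem isExtensionOfDegree_t (g : ℚ⟦X⟧) {d : ℕ} (hd : d ≠ 0)
    (hle : field {t ^ 3} ≤ field {theta g})
    (h : (field {t ^ 3}).relfinrank (field {theta g}) = d) :
    IsExtensionOfDegree (field {t}) (field {t} ⊔ field {theta g}) d := by
  have hg : t ^ 3 ∈ field {theta g} := hle (IntermediateField.mem_adjoin_simple_self ℚ _)
  have h1 := IntermediateField.relfinrank_mul_relfinrank hle
    (le_sup_left : _ ≤ field {theta g} ⊔ field {t})
  have h2 := IntermediateField.relfinrank_mul_relfinrank field_t_le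
    (le_sup_right : _ ≤ field {theta g} ⊔ field {t})
  rw [h, relfinrank_sup_t g hg] at h1
  rw [relfinrank_t] at h2
  refine isExtensionOfDegree_of_relfinrank le_sup_left ?_ hd
  rw [sup_comm]
  omega

theorem relfinrank_t_W : (field {t ^ 3}).relfinrank (field {W}) = 6 := by
  rw [← IntermediateField.relfinrank_mul_relfinrank field_V_le field_W_le, relfinrank_V,
    relfinrank_W]

theorem relfinrank_t_Z : (field {t ^ 3}).relfinrank (field {Z}) = 12 := by
  rw [← IntermediateField.relfinrank_mul_relfinrank (field_V_le.trans field_W_le) field_Z_le,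
    relfinrank_t_W, relfinrank_Z]

/-- Unlike `V`, its cube is a series in `t ^ 3`, so `isExtensionOfDegree_t` applies to it; `V = t (2
+ V ^ 3)` then gives `ℚ(t, V) = ℚ(t, V ^ 3)`. -/
theorem theta_V_pow_three : theta (4 * serWs * (1 - serWs)) = V ^ 3 := by
  rw [V_pow_three]
  simp only [map_mul, map_sub, map_one, map_ofNat, theta_serWs]

theorem isExtensionOfDegree_V : IsExtensionOfDegree (field {t}) (field {t} ⊔ field {V}) 3 := by
  have h := isExtensionOfDegree_t (4 * serWs * (1 - serWs)) three_ne_zero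
    (by rw [theta_V_pow_three]; exact field_V_le) (by rw [theta_V_pow_three]; exact relfinrank_V)
  rw [theta_V_pow_three] at h
  have heq : field {t} ⊔ field {V} = field {t} ⊔ field {V ^ 3} := by
    have ht : t ∈ field {t} ⊔ field {V ^ 3} :=
      le_sup_left (b := field {V ^ 3}) (IntermediateField.mem_adjoin_simple_self ℚ t)
    have hV : V ^ 3 ∈ field {t} ⊔ field {V ^ 3} :=
      le_sup_right (a := field {t}) (IntermediateField.mem_adjoin_simple_self ℚ (V ^ 3))
    refine le_antisymm (sup_le le_sup_left (IntermediateField.adjoin_simple_le_iff.2 ?_))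
      (sup_le le_sup_left (IntermediateField.adjoin_simple_le_iff.2 (pow_mem
        (le_sup_right (a := field {t}) (IntermediateField.mem_adjoin_simple_self ℚ V)) 3)))
    have h2 := mul_mem ht (add_mem (ofNat_mem _ 2) hV)
    rwa [← V_eq_t_mul] at h2
  rwa [heq]

theorem isExtensionOfDegree_W : IsExtensionOfDegree (field {t}) (field {t} ⊔ field {W}) 6 := by
  have h := isExtensionOfDegree_t serWs (d := 6) (by norm_num)
    (by rw [theta_serWs]; exact field_V_le.trans field_W_le)
    (by rw [theta_serWs]; exact relfinrank_t_W)
  rwa [theta_serWs] at h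

theorem isExtensionOfDegree_Z : IsExtensionOfDegree (field {t}) (field {t} ⊔ field {Z}) 12 := by
  have h := isExtensionOfDegree_t serZs (d := 12) (by norm_num)
    (by rw [theta_serZs]; exact (field_V_le.trans field_W_le).trans field_Z_le)
    (by rw [theta_serZs]; exact relfinrank_t_Z)
  rwa [theta_serZs] at h

theorem field_t_Z : field {t, Z} = field {t} ⊔ field {Z} := by
  rw [← IntermediateField.adjoin_union, Set.singleton_union]

end Degrees

end Kreweras

namespace Kreweras

/-! ### The explicit expressions, from coefficients of low order -/

section Explicit

section LowCoefficients

variable {R : Type*} [CommRing R] (f g : R⟦X⟧)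

theorem coeff_zero_mul_eq : PowerSeries.coeff 0 (f * g) =
    PowerSeries.coeff 0 f * PowerSeries.coeff 0 g := by
  simp

theorem coeff_one_mul_eq : PowerSeries.coeff 1 (f * g) =
    PowerSeries.coeff 0 f * PowerSeries.coeff 1 g +
      PowerSeries.coeff 1 f * PowerSeries.coeff 0 g := by
  simp [PowerSeries.coeff_mul, Finset.Nat.antidiagonal_succ]

theorem coeff_two_mul_eq : PowerSeries.coeff 2 (f * g) =
    PowerSeries.coeff 0 f * PowerSeries.coeff 2 g + PowerSeries.coeff 1 f * PowerSeries.coeff 1 g +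
      PowerSeries.coeff 2 f * PowerSeries.coeff 0 g := by
  simp [PowerSeries.coeff_mul, Finset.Nat.antidiagonal_succ]
  ring

theorem coeff_three_mul_eq : PowerSeries.coeff 3 (f * g) =
    PowerSeries.coeff 0 f * PowerSeries.coeff 3 g + PowerSeries.coeff 1 f * PowerSeries.coeff 2 g +
      PowerSeries.coeff 2 f * PowerSeries.coeff 1 g +
      PowerSeries.coeff 3 f * PowerSeries.coeff 0 g := by
  simp [PowerSeries.coeff_mul, Finset.Nat.antidiagonal_succ]
  ring

theorem coeff_two_X_mul : PowerSeries.coeff 2 (PowerSeries.X * f) = PowerSeries.coeff 1 f :=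
  PowerSeries.coeff_succ_X_mul 1 f

theorem coeff_three_X_mul : PowerSeries.coeff 3 (PowerSeries.X * f) = PowerSeries.coeff 2 f :=
  PowerSeries.coeff_succ_X_mul 2 f

variable (u v : R)

theorem quadratic_eq : (1 - PowerSeries.C u * PowerSeries.X +
      PowerSeries.C v * PowerSeries.X ^ 2 : R⟦X⟧) =
    1 + PowerSeries.X * (PowerSeries.C (-u) + PowerSeries.X * PowerSeries.C v) := by
  rw [map_neg]
  ring

theorem coeff_one_quadratic : PowerSeries.coeff 1 (1 - PowerSeries.C u * PowerSeries.X +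
    PowerSeries.C v * PowerSeries.X ^ 2 : R⟦X⟧) = -u := by
  rw [quadratic_eq, map_add, coeff_one_X_mul, PowerSeries.coeff_one]
  simp

theorem coeff_two_quadratic : PowerSeries.coeff 2 (1 - PowerSeries.C u * PowerSeries.X +
    PowerSeries.C v * PowerSeries.X ^ 2 : R⟦X⟧) = v := by
  rw [quadratic_eq, map_add, coeff_two_X_mul, PowerSeries.coeff_one, map_add, coeff_one_X_mul,
    PowerSeries.coeff_C]
  simp

theorem coeff_three_quadratic : PowerSeries.coeff 3 (1 - PowerSeries.C u * PowerSeries.X +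
    PowerSeries.C v * PowerSeries.X ^ 2 : R⟦X⟧) = 0 := by
  rw [quadratic_eq, map_add, coeff_three_X_mul, PowerSeries.coeff_one, map_add, coeff_two_X_mul,
    PowerSeries.coeff_C, PowerSeries.coeff_C]
  simp

end LowCoefficients

theorem coeff_zero_serS : PowerSeries.coeff 0 serS = 1 := by
  rw [PowerSeries.coeff_zero_eq_constantCoeff_apply, constantCoeff_serS]

theorem two_mul_coeff_two_serS : 2 * PowerSeries.coeff 2 serS =
    serP ^ 2 - PowerSeries.coeff 1 serS ^ 2 := by
  have h := congrArg (PowerSeries.coeff 2) serS_sq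
  rw [coeff_two_quadratic, sq, coeff_two_mul_eq, coeff_zero_serS] at h
  linear_combination h

theorem two_mul_coeff_three_serS : 2 * PowerSeries.coeff 3 serS =
    -2 * (PowerSeries.coeff 1 serS * PowerSeries.coeff 2 serS) := by
  have h := congrArg (PowerSeries.coeff 3) serS_sq
  rw [coeff_three_quadratic, sq, coeff_three_mul_eq, coeff_zero_serS] at h
  linear_combination h

theorem serB_sq_eq : PowerSeries.X * serB ^ 2 =
    PowerSeries.X * (PowerSeries.C (serc + 4 * PowerSeries.X * serP) * 1)
        + (PowerSeries.X * (PowerSeries.X * (PowerSeries.C 2 * PowerSeries.X - PowerSeries.C 2))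
          - PowerSeries.C (2 * PowerSeries.X) * 1
          + PowerSeries.C (2 * PowerSeries.X) * serS
          + PowerSeries.X * (PowerSeries.C (4 * PowerSeries.X * serP) * (serS - 1))
          - PowerSeries.X * (PowerSeries.X * (PowerSeries.C (2 * serP⁻¹) * serS))) := by
  rw [serB_sq]
  simp only [serI, map_add, map_mul, map_ofNat]
  ring

theorem coeff_one_serB_sq : PowerSeries.coeff 1 (serB ^ 2) =
    -2 + 2 * PowerSeries.X * PowerSeries.coeff 2 serS
      + 4 * PowerSeries.X * serP * PowerSeries.coeff 1 serS - 2 * serP⁻¹ := by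
  have h := congrArg (PowerSeries.coeff 2) serB_sq_eq
  simp only [map_add, map_sub, PowerSeries.coeff_C_mul, coeff_two_X_mul,
    coeff_one_X_mul] at h
  rw [h]
  simp [PowerSeries.coeff_one, constantCoeff_serS]

theorem coeff_two_serB_sq : PowerSeries.coeff 2 (serB ^ 2) =
    2 + 2 * PowerSeries.X * PowerSeries.coeff 3 serS
      + 4 * PowerSeries.X * serP * PowerSeries.coeff 2 serS
      - 2 * serP⁻¹ * PowerSeries.coeff 1 serS := by
  have h := congrArg (PowerSeries.coeff 3) serB_sq_eq
  simp only [map_add, map_sub, PowerSeries.coeff_C_mul, coeff_three_X_mul,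
    coeff_two_X_mul] at h
  rw [h]
  simp [PowerSeries.coeff_one]

theorem coeff_zero_serB_sq : PowerSeries.coeff 0 (serB ^ 2) = serr ^ 2 := by
  rw [PowerSeries.coeff_zero_eq_constantCoeff_apply, map_pow, constantCoeff_serB]

theorem coeff_serA_succ (b : ℕ) : PowerSeries.coeff (b + 1) serA = foldSer 0 b := by
  rw [serD_serR_eq.1, map_add, PowerSeries.coeff_succ_X_mul, PowerSeries.coeff_one,
    if_neg (by omega), zero_add, serD, PowerSeries.coeff_mk, foldSer]

theorem coeff_zero_serA : PowerSeries.coeff 0 serA = 1 := by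
  rw [PowerSeries.coeff_zero_eq_constantCoeff_apply, constantCoeff_serA]

/-- Squaring the formula for `A` removes the radicals: `B ^ 2`, `S ^ 2` and `r ^ 2` are explicit.
The coefficients of `y` and `y ^ 2` determine the series of walks ending at `(0, 0)` and `(1, 1)`.
-/
theorem serA_sq_mul : serA * serA * serB ^ 2 * (1 - PowerSeries.C (serP * (serP + 1)) *
      PowerSeries.X + PowerSeries.C (serP ^ 2) * PowerSeries.X ^ 2) =
    PowerSeries.C (serr ^ 2) * (1 - PowerSeries.C (4 * serP) * PowerSeries.X +
      PowerSeries.C (4 * serP ^ 2) * PowerSeries.X ^ 2) := by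
  rw [← serS_sq]
  calc _ = (serA * (serB * serS)) ^ 2 := by ring
    _ = _ := by
      rw [serA_mul]
      simp only [map_mul, map_pow, map_ofNat]
      ring

theorem coeff_zero_quadratic {R : Type*} [CommRing R] (u v : R) :
    PowerSeries.coeff 0 (1 - PowerSeries.C u * PowerSeries.X +
      PowerSeries.C v * PowerSeries.X ^ 2 : R⟦X⟧) = 1 := by
  simp

theorem foldSer_zero_zero_eq : PowerSeries.coeff 1 (serB ^ 2) + 2 * foldSer 0 0 * serr ^ 2
    - serP * (serP + 1) * serr ^ 2 = -4 * serP * serr ^ 2 := by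
  have h := congrArg (PowerSeries.coeff 1) serA_sq_mul
  have h1 : PowerSeries.coeff 1 serA = foldSer 0 0 := coeff_serA_succ 0
  simp only [coeff_one_mul_eq, coeff_zero_mul_eq, PowerSeries.coeff_C_mul,
    coeff_one_quadratic, coeff_zero_quadratic, coeff_zero_serA, coeff_zero_serB_sq, h1] at h
  linear_combination h

theorem foldSer_zero_one_eq : PowerSeries.coeff 2 (serB ^ 2)
    + 2 * foldSer 0 0 * PowerSeries.coeff 1 (serB ^ 2)
    + (2 * foldSer 0 1 + foldSer 0 0 ^ 2) * serr ^ 2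
    - serP * (serP + 1) * (PowerSeries.coeff 1 (serB ^ 2) + 2 * foldSer 0 0 * serr ^ 2)
    + serP ^ 2 * serr ^ 2 = 4 * serP ^ 2 * serr ^ 2 := by
  have h := congrArg (PowerSeries.coeff 2) serA_sq_mul
  have h1 : PowerSeries.coeff 1 serA = foldSer 0 0 := coeff_serA_succ 0
  have h2 : PowerSeries.coeff 2 serA = foldSer 0 1 := coeff_serA_succ 1
  simp only [coeff_two_mul_eq, coeff_one_mul_eq, coeff_zero_mul_eq,
    PowerSeries.coeff_C_mul, coeff_two_quadratic,
    coeff_one_quadratic, coeff_zero_quadratic, coeff_zero_serA, coeff_zero_serB_sq, h1, h2] at h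
  linear_combination h

theorem one_sub_W_ne_zero : 1 - W ≠ 0 := by
  have := theta_ne_zero_of_constantCoeff (f := 1 - serWs) (by simp [constantCoeff_serWs])
  simpa only [map_sub, map_one, theta_serWs] using this

theorem one_add_W_ne_zero : 1 + W ≠ 0 := by
  have := theta_ne_zero_of_constantCoeff (f := 1 + serWs) (by simp [constantCoeff_serWs])
  simpa only [map_add, map_one, theta_serWs] using this

theorem t_pow_three_eq_W : t ^ 3 = W * (1 - W) / (2 * theta serP ^ 3) := by
  rw [eq_div_iff (mul_ne_zero (laurentSeries_ofNat_ne_zero 2) (pow_ne_zero 3 theta_serP_ne_zero))]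
  have h := t_pow_three
  have hp := theta_serP
  refine mul_left_cancel₀ (laurentSeries_ofNat_ne_zero 2) ?_
  linear_combination h + hp

theorem theta_serr_sq : theta serr ^ 2 = (1 - W) * (1 + W) ^ 3 / theta serP ^ 2 := by
  have h := congrArg theta serr_sq
  simp only [map_mul, map_pow, map_sub, map_add, map_one, theta_serWs] at h
  rw [eq_div_iff (pow_ne_zero 2 theta_serP_ne_zero), ← h]
  ring

theorem theta_serP_inv : theta serP⁻¹ = 1 / theta serP := by
  have h := congrArg theta serP_mul_inv
  rw [map_mul, map_one] at h
  rw [eq_div_iff theta_serP_ne_zero, mul_comm, h]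

theorem eq_div_two {x y : LaurentSeries ℚ} (h : 2 * x = y) : x = y / 2 := by
  rw [eq_div_iff (laurentSeries_ofNat_ne_zero 2), ← h, mul_comm]

theorem theta_coeff_one_serS :
    theta (PowerSeries.coeff 1 serS) = -(theta serP * (theta serP + 1)) / 2 :=
  eq_div_two (by
    have := congrArg theta two_mul_coeff_one_serS
    simpa only [map_mul, map_ofNat, map_neg, map_add, map_one] using this)

theorem theta_coeff_two_serS : theta (PowerSeries.coeff 2 serS) =
    (theta serP ^ 2 - theta (PowerSeries.coeff 1 serS) ^ 2) / 2 :=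
  eq_div_two (by
    have := congrArg theta two_mul_coeff_two_serS
    simpa only [map_mul, map_ofNat, map_sub, map_pow] using this)

theorem theta_coeff_three_serS : theta (PowerSeries.coeff 3 serS) =
    -2 * (theta (PowerSeries.coeff 1 serS) * theta (PowerSeries.coeff 2 serS)) / 2 :=
  eq_div_two (by
    have := congrArg theta two_mul_coeff_three_serS
    simpa only [map_mul, map_ofNat, map_neg] using this)

theorem theta_coeff_one_serB_sq : theta (PowerSeries.coeff 1 (serB ^ 2)) =
    -2 + 2 * t ^ 3 * theta (PowerSeries.coeff 2 serS)
      + 4 * t ^ 3 * theta serP * theta (PowerSeries.coeff 1 serS) - 2 * theta serP⁻¹ := by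
  rw [coeff_one_serB_sq]
  simp only [map_mul, map_ofNat, map_sub, map_add, map_neg, theta_X]

theorem theta_coeff_two_serB_sq : theta (PowerSeries.coeff 2 (serB ^ 2)) =
    2 + 2 * t ^ 3 * theta (PowerSeries.coeff 3 serS)
      + 4 * t ^ 3 * theta serP * theta (PowerSeries.coeff 2 serS)
      - 2 * theta serP⁻¹ * theta (PowerSeries.coeff 1 serS) := by
  rw [coeff_two_serB_sq]
  simp only [map_mul, map_ofNat, map_sub, map_add, theta_X]

theorem theta_foldSer_zero_zero : theta (foldSer 0 0) =
    (1 + 2 * W - 2 * W ^ 2) * (3 * W ^ 3 - 2 * W ^ 2 - 4 * W + 4) / (4 * (1 - W)) := by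
  have h := congrArg theta foldSer_zero_zero_eq
  simp only [map_mul, map_ofNat, map_sub, map_add, map_neg, map_pow, map_one] at h
  have hr := pow_ne_zero 2 theta_serr_ne_zero
  have h2 : (2 : LaurentSeries ℚ) ≠ 0 := laurentSeries_ofNat_ne_zero 2
  have h4 : (4 : LaurentSeries ℚ) ≠ 0 := laurentSeries_ofNat_ne_zero 4
  have hW := one_sub_W_ne_zero
  have hW' := one_add_W_ne_zero
  have hp0 := theta_serP_ne_zero
  have hp := theta_serP
  have h' : theta (foldSer 0 0) = (theta serP * (theta serP + 1) * theta serr ^ 2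
      - 4 * theta serP * theta serr ^ 2 - theta (PowerSeries.coeff 1 (serB ^ 2))) /
      (2 * theta serr ^ 2) := by
    rw [eq_div_iff (mul_ne_zero h2 hr)]
    linear_combination h
  rw [h', theta_coeff_one_serB_sq, theta_coeff_two_serS, theta_coeff_one_serS, theta_serP_inv,
    theta_serr_sq, t_pow_three_eq_W]
  generalize theta serP = p at *
  field_simp
  rw [hp]
  ring

theorem t_pow_three_mul_theta_foldSer_zero_one : t ^ 3 * theta (foldSer 0 1) =
    W * (35 * W ^ 6 - 100 * W ^ 5 + 20 * W ^ 4 + 144 * W ^ 3 - 96 * W ^ 2 - 32 * W + 32) /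
      (64 * (1 - W) * (1 + 2 * W - 2 * W ^ 2)) := by
  have h := congrArg theta foldSer_zero_one_eq
  simp only [map_mul, map_ofNat, map_sub, map_add, map_pow, map_one] at h
  have hr := pow_ne_zero 2 theta_serr_ne_zero
  have h2 : (2 : LaurentSeries ℚ) ≠ 0 := laurentSeries_ofNat_ne_zero 2
  have h4 : (4 : LaurentSeries ℚ) ≠ 0 := laurentSeries_ofNat_ne_zero 4
  have h64 : (64 : LaurentSeries ℚ) ≠ 0 := laurentSeries_ofNat_ne_zero 64
  have hW := one_sub_W_ne_zero
  have hW' := one_add_W_ne_zero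
  have hp0 := theta_serP_ne_zero
  have hp := theta_serP
  have h' : theta (foldSer 0 1) = (4 * theta serP ^ 2 * theta serr ^ 2
      - (theta (PowerSeries.coeff 2 (serB ^ 2))
        + 2 * theta (foldSer 0 0) * theta (PowerSeries.coeff 1 (serB ^ 2))
        + theta (foldSer 0 0) ^ 2 * theta serr ^ 2
        - theta serP * (theta serP + 1) * (theta (PowerSeries.coeff 1 (serB ^ 2))
          + 2 * theta (foldSer 0 0) * theta serr ^ 2)
        + theta serP ^ 2 * theta serr ^ 2)) / (2 * theta serr ^ 2) := by
    rw [eq_div_iff (mul_ne_zero h2 hr)]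
    linear_combination h
  rw [h', theta_foldSer_zero_zero, theta_coeff_two_serB_sq, theta_coeff_one_serB_sq,
    theta_coeff_three_serS, theta_coeff_two_serS, theta_coeff_one_serS, theta_serP_inv,
    theta_serr_sq, t_pow_three_eq_W, ← hp]
  generalize theta serP = p at *
  field_simp
  rw [hp]
  ring

theorem C_zero_zero : C 0 0 = theta (foldSer 0 0) := by
  simpa using C_eq_theta 0 0

theorem t_mul_C_zero_one : t * C 0 1 = (C 0 0 - 1) / 2 := by
  have h := congrArg theta two_mul_X_mul_foldSer_one_one
  rw [map_mul, map_mul, map_ofNat, theta_X, map_sub, map_one, ← C_zero_zero] at h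
  refine eq_div_two ?_
  have h1 : C 1 0 = t ^ 2 * theta (foldSer 1 1) := by simpa using C_eq_theta 1 1
  rw [C_symm, h1]
  linear_combination h

theorem t_sq_mul_C_one_one : t ^ 2 * C 1 1 = t ^ 3 * theta (foldSer 0 1) := by
  have h1 : C 1 1 = t * theta (foldSer 0 1) := by simpa using C_eq_theta 0 1
  rw [h1]
  ring

/-- This is the constant term of the relation between `R` and `B`, where `B(0) = r`. -/
theorem t_sq_mul_C_neg_one_zero : t ^ 2 * C (-1) 0 = (1 - theta serr) / 2 := by
  have h := congrArg theta (two_mul_X_mul_foldSer_succ_zero 0)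
  have h0 : PowerSeries.coeff 0 (1 - 2 * PowerSeries.X - serB) = 1 - serr := by
    simp [PowerSeries.coeff_zero_eq_constantCoeff_apply, constantCoeff_serB]
  rw [h0, map_mul, map_mul, map_ofNat, theta_X, map_sub, map_one] at h
  refine eq_div_two ?_
  have h1 : C 0 (-1) = t * theta (foldSer 1 0) := by simpa using C_eq_theta 1 0
  rw [C_symm, h1]
  linear_combination h

theorem theta_serP_eq_Z : theta serP =
    (Z ^ 4 + 4 * Z ^ 3 - 6 * Z ^ 2 + 4 * Z + 1) / (1 + Z ^ 2) ^ 2 := by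
  have hZ := one_add_Z_sq_ne_zero
  rw [theta_serP, W_eq]
  field_simp
  ring

theorem t_sq_mul_C_neg_one_zero_eq : t ^ 2 * C (-1) 0 =
    Z * (Z ^ 3 + 3 * Z ^ 2 - 3 * Z + 1) / (Z ^ 4 + 4 * Z ^ 3 - 6 * Z ^ 2 + 4 * Z + 1) := by
  have hZ := one_add_Z_sq_ne_zero
  have hp := theta_serP_ne_zero
  have hq : Z ^ 4 + 4 * Z ^ 3 - 6 * Z ^ 2 + 4 * Z + 1 ≠ 0 := fun h => hp (by
    rw [theta_serP_eq_Z, h, zero_div])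
  have h2 : (2 : LaurentSeries ℚ) ≠ 0 := laurentSeries_ofNat_ne_zero 2
  rw [t_sq_mul_C_neg_one_zero, theta_serr, theta_serP_eq_Z, W_eq]
  obtain ⟨q, h⟩ : ∃ q, q = Z ^ 4 + 4 * Z ^ 3 - 6 * Z ^ 2 + 4 * Z + 1 := ⟨_, rfl⟩
  rw [← h] at hq ⊢
  field_simp
  rw [h]
  ring

end Explicit

end Kreweras

namespace Kreweras

/-! ### Passage to arbitrary endpoints of the cone -/

section Conclusion

theorem t_mul_C_zero_one_eq : t * C 0 1 =
    W * (-6 * W ^ 4 + 10 * W ^ 3 + 7 * W ^ 2 - 18 * W + 8) / (8 * (1 - W)) := by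
  have h2 : (2 : LaurentSeries ℚ) ≠ 0 := laurentSeries_ofNat_ne_zero 2
  have h4 : (4 : LaurentSeries ℚ) ≠ 0 := laurentSeries_ofNat_ne_zero 4
  have h8 : (8 : LaurentSeries ℚ) ≠ 0 := laurentSeries_ofNat_ne_zero 8
  have hW := one_sub_W_ne_zero
  rw [t_mul_C_zero_one, C_zero_zero, theta_foldSer_zero_zero]
  field_simp
  ring

theorem theta_serr_mem_field_Z : theta serr ∈ field {Z} := by
  have hZ := IntermediateField.mem_adjoin_simple_self ℚ Z
  have hone : (1 : LaurentSeries ℚ) ∈ field {Z} := one_mem _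
  rw [theta_serr]
  exact div_mem (mul_mem (add_mem hone W_mem_field) (sub_mem hone (pow_mem hZ 2)))
    (mul_mem (add_mem hone (pow_mem hZ 2)) (theta_serP_mem W_mem_field))

theorem t_zpow_mul_C_mem {K : IntermediateField ℚ (LaurentSeries ℚ)} (hW : W ∈ K) {i j : ℤ}
    {a b : ℕ} (hi : i = b) (hj : j = b - a) (h : theta (foldSer a b) ∈ K) :
    t ^ (i + j) * C i j ∈ K := by
  rw [hi, hj, t_zpow_mul_C]
  exact mul_mem (pow_mem (t_pow_three_mem hW) b) h

theorem t_zpow_mul_C_symm (i j : ℤ) : t ^ (i + j) * C i j = t ^ (j + i) * C j i := by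
  rw [add_comm, C_symm]

theorem t_zpow_mul_C_mem_field_Z {i j : ℤ} (h : (i, j) ∈ cone) :
    t ^ (i + j) * C i j ∈ field {Z} := by
  wlog hij : j ≤ i generalizing i j
  · rw [t_zpow_mul_C_symm]
    exact this (Or.symm h) (by omega)
  have hi : 0 ≤ i := by
    rcases h with h | h
    · exact h
    · exact le_trans h hij
  -- Below the diagonal the folded coordinates are `a = i - j` and `b = i`, both nonnegative.
  exact t_zpow_mul_C_mem W_mem_field (a := (i - j).toNat) (b := i.toNat) (by omega) (by omega)
    (foldSer_mem W_mem_field theta_serr_mem_field_Z _ _)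

theorem t_zpow_mul_C_mem_field_W {i j : ℤ} (hi : 0 ≤ i) (hj : 0 ≤ j)
    (h : i = j ∨ i = j + 1 ∨ i = j - 1) : t ^ (i + j) * C i j ∈ field {W} := by
  have hW := IntermediateField.mem_adjoin_simple_self ℚ W
  wlog hij : j ≤ i generalizing i j
  · rw [t_zpow_mul_C_symm]
    exact this hj hi (by omega) (by omega)
  rcases hij.eq_or_lt with rfl | hlt
  · exact t_zpow_mul_C_mem hW (a := 0) (b := j.toNat) (by omega) (by omega)
      (foldSer_zero_mem hW _)
  · exact t_zpow_mul_C_mem hW (a := 1) (b := j.toNat + 1) (by omega) (by omega)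
      (foldSer_one_mem hW _)

theorem C_mem_of_t_zpow_mul_C_mem {K : IntermediateField ℚ (LaurentSeries ℚ)} {i j : ℤ}
    (h : t ^ (i + j) * C i j ∈ K) : C i j ∈ field {t} ⊔ K := by
  have ht : t ∈ field {t} ⊔ K :=
    (le_sup_left : _ ≤ field {t} ⊔ K) (IntermediateField.mem_adjoin_simple_self ℚ t)
  have h1 := mul_mem (inv_mem (zpow_mem ht (i + j))) ((le_sup_right : _ ≤ field {t} ⊔ K) h)
  rwa [inv_mul_cancel_left₀ (zpow_ne_zero _ t_ne_zero)] at h1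

end Conclusion

end Kreweras

theorem corollary1p3 :
    -- the extensions: degrees of `V`, `W`, `Z` over `ℚ(t)`
    (Kreweras.HasDegree (Kreweras.field {Kreweras.t}) Kreweras.V 3 ∧
      Kreweras.HasDegree (Kreweras.field {Kreweras.t}) Kreweras.W 6 ∧
      Kreweras.HasDegree (Kreweras.field {Kreweras.t}) Kreweras.Z 12) ∧
    -- the tower `ℚ(t³) ⊂ ℚ(V³) ⊂ ℚ(W) ⊂ ℚ(Z)`, and the extension `ℚ(t, Z)` of `ℚ(t)`
    (Kreweras.IsExtensionOfDegree
        (Kreweras.field {Kreweras.t ^ 3}) (Kreweras.field {Kreweras.V ^ 3}) 3 ∧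
      Kreweras.IsExtensionOfDegree
        (Kreweras.field {Kreweras.V ^ 3}) (Kreweras.field {Kreweras.W}) 2 ∧
      Kreweras.IsExtensionOfDegree
        (Kreweras.field {Kreweras.W}) (Kreweras.field {Kreweras.Z}) 2 ∧
      Kreweras.IsExtensionOfDegree
        (Kreweras.field {Kreweras.t}) (Kreweras.field {Kreweras.t, Kreweras.Z}) 12) ∧
    -- any endpoint in the cone
    (∀ i j : ℤ, (i, j) ∈ Kreweras.cone →
      Kreweras.HasDegreeAtMost (Kreweras.field {Kreweras.t}) (Kreweras.C i j) 12 ∧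
      Kreweras.C i j ∈ Kreweras.field {Kreweras.t, Kreweras.Z} ∧
      Kreweras.t ^ (i + j) * Kreweras.C i j ∈ Kreweras.field {Kreweras.Z}) ∧
    -- endpoints on, just above or just below the diagonal
    (∀ i j : ℤ, 0 ≤ i → 0 ≤ j → (i = j ∨ i = j + 1 ∨ i = j - 1) →
      Kreweras.HasDegreeAtMost (Kreweras.field {Kreweras.t})
        (Kreweras.t ^ (i + j) * Kreweras.C i j) 6 ∧
      Kreweras.t ^ (i + j) * Kreweras.C i j ∈ Kreweras.field {Kreweras.W}) ∧
    -- explicit examples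
    (Kreweras.C 0 0 =
      (1 + 2 * Kreweras.W - 2 * Kreweras.W ^ 2) *
        (3 * Kreweras.W ^ 3 - 2 * Kreweras.W ^ 2 - 4 * Kreweras.W + 4) /
        (4 * (1 - Kreweras.W))) ∧
    (Kreweras.t * Kreweras.C 0 1 = (Kreweras.C 0 0 - 1) / 2 ∧
      Kreweras.t * Kreweras.C 0 1 =
        Kreweras.W * (-6 * Kreweras.W ^ 4 + 10 * Kreweras.W ^ 3 + 7 * Kreweras.W ^ 2
          - 18 * Kreweras.W + 8) / (8 * (1 - Kreweras.W))) ∧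
    (Kreweras.t ^ 2 * Kreweras.C 1 1 =
      Kreweras.W * (35 * Kreweras.W ^ 6 - 100 * Kreweras.W ^ 5 + 20 * Kreweras.W ^ 4
        + 144 * Kreweras.W ^ 3 - 96 * Kreweras.W ^ 2 - 32 * Kreweras.W + 32) /
        (64 * (1 - Kreweras.W) * (1 + 2 * Kreweras.W - 2 * Kreweras.W ^ 2))) ∧
    (Kreweras.t ^ 2 * Kreweras.C (-1) 0 =
      Kreweras.Z * (Kreweras.Z ^ 3 + 3 * Kreweras.Z ^ 2 - 3 * Kreweras.Z + 1) /
        (Kreweras.Z ^ 4 + 4 * Kreweras.Z ^ 3 - 6 * Kreweras.Z ^ 2 + 4 * Kreweras.Z + 1)) := by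
  have hZ := Kreweras.isExtensionOfDegree_Z
  refine ⟨⟨Kreweras.hasDegree_of_isExtensionOfDegree Kreweras.isExtensionOfDegree_V,
      Kreweras.hasDegree_of_isExtensionOfDegree Kreweras.isExtensionOfDegree_W,
      Kreweras.hasDegree_of_isExtensionOfDegree hZ⟩,
    ⟨Kreweras.isExtensionOfDegree_of_relfinrank Kreweras.field_V_le Kreweras.relfinrank_V
        (by norm_num),
      Kreweras.isExtensionOfDegree_of_relfinrank Kreweras.field_W_le Kreweras.relfinrank_W
        (by norm_num),
      Kreweras.isExtensionOfDegree_of_relfinrank Kreweras.field_Z_le Kreweras.relfinrank_Z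
        (by norm_num), Kreweras.field_t_Z ▸ hZ⟩,
    fun i j hij => ?_, fun i j hi hj hij => ?_, ?_, ⟨Kreweras.t_mul_C_zero_one,
      Kreweras.t_mul_C_zero_one_eq⟩, ?_, Kreweras.t_sq_mul_C_neg_one_zero_eq⟩
  · have h := Kreweras.t_zpow_mul_C_mem_field_Z hij
    have h' := Kreweras.C_mem_of_t_zpow_mul_C_mem h
    exact ⟨Kreweras.hasDegreeAtMost_of_mem hZ h', Kreweras.field_t_Z ▸ h', h⟩
  · have h := Kreweras.t_zpow_mul_C_mem_field_W hi hj hij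
    exact ⟨Kreweras.hasDegreeAtMost_of_mem Kreweras.isExtensionOfDegree_W
      ((le_sup_right : _ ≤ Kreweras.field {Kreweras.t} ⊔ _) h), h⟩
  · rw [Kreweras.C_zero_zero, Kreweras.theta_foldSer_zero_zero]
  · rw [Kreweras.t_sq_mul_C_one_one, Kreweras.t_pow_three_mul_theta_foldSer_zero_one]
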